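/- **Conventions.** A *Fréchet Lie group* is a group $G$ that is a Hausdorff smooth manifold modelled on a complete Hausdorff locally convex real vector space (metrizability is not needed), with smooth multiplication and inversion; smooth means $C^\infty$ in the Michal–Bastiani sense (iterated directional derivatives exist and are jointly continuous). Let $\Delta^n=\{x\in\mathbb R^n : x_i\ge 0,\ \sum_i x_i\le 1\}$, and call a map on (an open subset of) $\Delta^n$ smooth if it extends smoothly to an open subset of $\mathbb R^n$ around each point. A *smooth simplicial set* $X$ is a contravariant functor to sets from the category $\Delta^{sm}$ of the simplices $\Delta^n$, $n\ge 0$, and all smooth maps between them; smooth maps $X\to X'$ are natural transformations. For $\Sigma\in X(n)$ and a smooth $\sigma:\Delta^k\to\Delta^n$ write $\Sigma_*(\sigma)\in X(k)$ for $X(\sigma)(\Sigma)$. For $Y$ a simplex or a smooth manifold, $Y_\bullet$ denotes the smooth simplicial set with $Y_\bullet(n)=\{\text{smooth maps }\Delta^n\to Y\}$. Products are formed degreewise. Smooth maps $f,g:X\to X'$ are *smoothly homotopic* if there is a smooth map $H:X\times\Delta^1_\bullet\to X'$ with $H(\Sigma,c_0)=f(\Sigma)$ and $H(\Sigma,c_1)=g(\Sigma)$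 for all simplices $\Sigma$ of $X$, where $c_0,c_1$ are the constant simplices at the vertices $0,1$ of $\Delta^1$. $\Delta^{sm}(X)$ is the category whose objects are the simplices of $X$ and whose morphisms from $\Sigma_1\in X(k)$ to $\Sigma_2\in X(n)$ are the smooth $m:\Delta^k\to\Delta^n$ with $(\Sigma_2)_*(m)=\Sigma_1$. A *simplicial $G$-bundle* $P\to X$ is a functor from $\Delta^{sm}(X)$ to smooth principal $G$-bundles and smooth $G$-bundle maps that sends each $n$-simplex to a bundle over $\Delta^n$ and each morphism $m$ to a bundle map over $m$. An isomorphism of simplicial $G$-bundles over $X$ is a natural isomorphism consisting of bundle maps over the identities of the simplices. A smooth map $f:X\to X'$ induces a functor $\Delta^{sm}f:\Delta^{sm}(X)\to\Delta^{sm}(X')$, and $f^*P:=P\circ\Delta^{sm}f$ for $P\to X'$. Given a universe $\mathcal U$ that contains $G$ (and all $\Delta^n$), $P$ is *$\mathcal U$-small* if the total spaces of all the bundles $P(\Sigma)$ belong to $\mathcal U$. $BG^{\mathcal U}$ is the smooth simplicial set whose $n$-simplices are the $\mathcal U$-small simplicial $G$-bundles $P\to\Delta^n_\bullet$, with $P_*(\sigma)=(\sigma_\bullet)^*P$,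 where $\sigma_\bullet(\rho)=\sigma\circ\rho$. The universal simplicial $G$-bundle $EG^{\mathcal U}\to BG^{\mathcal U}$ sends the simplex $P\to\Delta^n_\bullet$ to the bundle $P(\mathrm{id}_{\Delta^n})$, and a morphism $m:\Delta^k\to\Delta^n$ from $(m_\bullet)^*P$ to $P$ to the bundle map $P(m)\to P(\mathrm{id}_{\Delta^n})$ that $P$ assigns to the morphism $m\to\mathrm{id}_{\Delta^n}$ of $\Delta^{sm}(\Delta^n_\bullet)$ given by $m$. A smooth map $f:X\to BG^{\mathcal U}$ *classifies* a simplicial $G$-bundle $P\to X$ if $f^*EG^{\mathcal U}\cong P$. **Theorem.** Let $G$ be a Fréchet Lie group and $\mathcal U$ a universe as above. 1. To every smooth simplicial set $X$ and every $\mathcal U$-small simplicial $G$-bundle $P\to X$ one can assign a smooth map $f_P:X\to BG^{\mathcal U}$ with $f_P^*EG^{\mathcal U}=P$ (in particular $f_P$ classifies $P$), naturally: $f_{h^*P}=f_P\circ h$ for every smooth map $h:X'\to X$. 2. Let $X$ be a smooth simplicial set. If $P_1,P_2\to X$ are isomorphic $\mathcal U$-small simplicial $G$-bundles, and $f_1,f_2:X\to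 BG^{\mathcal U}$ are any smooth maps that classify $P_1$ and $P_2$ respectively, then $f_1$ and $f_2$ are smoothly homotopic. 3. Let $Y$ be a finite-dimensional smooth manifold (Hausdorff, second countable, without boundary). If $f,g:Y_\bullet\to BG^{\mathcal U}$ are smoothly homotopic smooth maps, then $f^*EG^{\mathcal U}$ and $g^*EG^{\mathcal U}$ are isomorphic simplicial $G$-bundles. -/

import Mathlib

open scoped Manifold ContDiff Topology

universe u v w w' w'' y

namespace SmoothSimplicial

/-! ### Smooth maps between locally convex spaces, and Fréchet Lie groups -/

/-- `f` is of class `C^n` on the open set `U` (in the sense of Michal, Bastiani and Hamilton): `f` is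
continuous on `U` and, for `n ≥ 1`, all directional derivatives `df (x, h)` exist for `x ∈ U` and
`df : U × E → F` is of class `C^(n-1)`. -/
def IsCk : ℕ → ∀ {E : Type u} {F : Type v} [AddCommGroup E] [Module ℝ E] [TopologicalSpace E]
    [AddCommGroup F] [Module ℝ F] [TopologicalSpace F], (E → F) → Set E → Prop
  | 0, _, _, _, _, _, _, _, _, f, U => ContinuousOn f U
  | n + 1, E, F, _, _, _, _, _, _, f, U => ContinuousOn f U ∧ ∃ df : E × E → F,
      (∀ x ∈ U, ∀ h : E,
        Filter.Tendsto (fun t : ℝ => t⁻¹ • (f (x + t • h) - f x)) (𝓝[≠] 0) (𝓝 (df (x, h)))) ∧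
      IsCk n df (U ×ˢ Set.univ)

/-- `f` is smooth (of class `C^∞`) on the open set `U`. -/
def IsSmoothOn {E : Type u} {F : Type v} [AddCommGroup E] [Module ℝ E] [TopologicalSpace E]
    [AddCommGroup F] [Module ℝ F] [TopologicalSpace F] (f : E → F) (U : Set E) : Prop :=
  ∀ n : ℕ, IsCk n f U

/-- The charted space `G`, modelled on the locally convex space `E`, is a Lie group: the changes of
charts, the multiplication and the inversion are smooth. -/
class IsFrechetLieGroup (E : Type v) [AddCommGroup E] [Module ℝ E] [TopologicalSpace E]
    (G : Type u) [TopologicalSpace G] [ChartedSpace E G] [Group G] : Prop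
    extends IsTopologicalGroup G where
  smooth_charts : ∀ a ∈ atlas E G, ∀ b ∈ atlas E G,
    IsSmoothOn (fun x : E => b (a.symm x)) {x | x ∈ a.target ∧ a.symm x ∈ b.source}
  smooth_mul : ∀ a ∈ atlas E G, ∀ b ∈ atlas E G, ∀ c ∈ atlas E G,
    IsSmoothOn (fun x : E × E => c (a.symm x.1 * b.symm x.2))
      {x | x.1 ∈ a.target ∧ x.2 ∈ b.target ∧ a.symm x.1 * b.symm x.2 ∈ c.source}
  smooth_inv : ∀ a ∈ atlas E G, ∀ b ∈ atlas E G,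
    IsSmoothOn (fun x : E => b (a.symm x)⁻¹) {x | x ∈ a.target ∧ (a.symm x)⁻¹ ∈ b.source}

/-- A map `h` from (an open subset `V` of) a finite-dimensional coordinate space to a manifold `G`
modelled on the locally convex space `E` is smooth on `V`: it is continuous, and smooth in all
charts. -/
def SmoothOnInto (E : Type v) [AddCommGroup E] [Module ℝ E] [TopologicalSpace E]
    {G : Type u} [TopologicalSpace G] [ChartedSpace E G] {n : ℕ}
    (h : (Fin n → ℝ) → G) (V : Set (Fin n → ℝ)) : Prop :=
  ContinuousOn h V ∧ ∀ a ∈ atlas E G, IsSmoothOn (fun x => a (h x)) {x | x ∈ V ∧ h x ∈ a.source}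

/-! ### Topological simplices and smooth maps out of them -/

/-- The topological simplex `Δ^n = {x ∈ ℝ^n | x_i ≥ 0, x_1 + ... + x_n ≤ 1}`. -/
def simplexSet (n : ℕ) : Set (Fin n → ℝ) := {x | (∀ i, 0 ≤ x i) ∧ ∑ i, x i ≤ 1}

/-- The topological simplex `Δ^n`, as a type. -/
abbrev Simplex (n : ℕ) : Type := ↥(simplexSet n)

/-- A map from `Δ^k` to a finite-dimensional manifold `M` is smooth, as a map of manifolds with
corners: around each point of `Δ^k` it extends to a smooth map on an open subset of `ℝ^k`. -/
def SimplexSmooth {H : Type v} [NormedAddCommGroup H] [NormedSpace ℝ H] {B : Type w}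
    [TopologicalSpace B] (I : ModelWithCorners ℝ H B) {M : Type u} [TopologicalSpace M]
    [ChartedSpace B M] {k : ℕ} (f : Simplex k → M) : Prop :=
  ∀ x : Simplex k, ∃ (V : Set (Fin k → ℝ)) (F : (Fin k → ℝ) → M), IsOpen V ∧ x.1 ∈ V ∧
    ContMDiffOn 𝓘(ℝ, Fin k → ℝ) I ∞ F V ∧ ∀ y : Simplex k, y.1 ∈ V → F y.1 = f y

/-- A map `h` from the open subset `U` of `Δ^n` to a manifold `G` modelled on the locally convex
space `E` is smooth: around each point of `U` it extends to a smooth map on an open subset of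
`ℝ^n`. -/
def SimplexSmoothOnInto (E : Type v) [AddCommGroup E] [Module ℝ E] [TopologicalSpace E]
    {G : Type u} [TopologicalSpace G] [ChartedSpace E G] {n : ℕ}
    (h : Simplex n → G) (U : Set (Simplex n)) : Prop :=
  ∀ x ∈ U, ∃ (V : Set (Fin n → ℝ)) (F : (Fin n → ℝ) → G), IsOpen V ∧ x.1 ∈ V ∧
    SmoothOnInto E F V ∧ ∀ y ∈ U, y.1 ∈ V → F y.1 = h y

/-- Smooth maps `Δ^k → Δ^n`. -/
@[ext]
structure SmoothMap (k n : ℕ) where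
  toFun : Simplex k → Simplex n
  smooth : SimplexSmooth 𝓘(ℝ, Fin n → ℝ) (fun x => (toFun x).1)

theorem SimplexSmooth.comp {H : Type v} [NormedAddCommGroup H] [NormedSpace ℝ H] {B : Type w}
    [TopologicalSpace B] {I : ModelWithCorners ℝ H B} {M : Type u} [TopologicalSpace M]
    [ChartedSpace B M] {k n : ℕ} {f : Simplex n → M} (hf : SimplexSmooth I f)
    (m : SmoothMap k n) : SimplexSmooth I (fun x => f (m.toFun x)) := by
  intro x
  obtain ⟨V, F, hV, hxV, hF, hFf⟩ := m.smooth x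
  obtain ⟨W, F', hW, hxW, hF', hFf'⟩ := hf (m.toFun x)
  refine ⟨V ∩ F ⁻¹' W, F' ∘ F, hF.continuousOn.isOpen_inter_preimage hV hW, ⟨hxV, ?_⟩,
    hF'.comp (hF.mono Set.inter_subset_left) Set.inter_subset_right, ?_⟩
  · simpa [hFf x hxV] using hxW
  · rintro y ⟨hyV, hyW⟩
    have h1 := hFf y hyV
    have h2 : (m.toFun y).1 ∈ W := by simpa [h1] using hyW
    simp only [Function.comp_apply, h1]
    exact hFf' _ h2

namespace SmoothMap

/-- The identity of `Δ^n`. -/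
def id (n : ℕ) : SmoothMap n n where
  toFun x := x
  smooth _ := ⟨Set.univ, fun y => y, isOpen_univ, trivial, contMDiffOn_id, fun _ _ => rfl⟩

/-- Composition of smooth maps between simplices. -/
def comp {k n l : ℕ} (s : SmoothMap n l) (m : SmoothMap k n) : SmoothMap k l where
  toFun x := s.toFun (m.toFun x)
  smooth := s.smooth.comp m

/-- Constant maps between simplices. -/
def const (k : ℕ) {n : ℕ} (p : Simplex n) : SmoothMap k n where
  toFun _ := p
  smooth _ := ⟨Set.univ, fun _ => p.1, isOpen_univ, trivial, contMDiffOn_const, fun _ _ => rfl⟩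

end SmoothMap

/-! ### Smooth simplicial sets -/

/-- A smooth simplicial set: a contravariant functor to sets from the category whose objects are the
topological simplices `Δ^n` and whose morphisms are all smooth maps. Here `map σ Σ` is the simplex
that is also written `Σ_*(σ)`; the underlying simplicial set is obtained by restriction to the
affine maps that preserve vertices and their order. -/
structure SmoothSSet where
  obj : ℕ → Type w
  map : ∀ {k n : ℕ}, SmoothMap k n → obj n → obj k
  map_id : ∀ {n : ℕ} (S : obj n), map (SmoothMap.id n) S = S
  map_comp : ∀ {k n l : ℕ} (s : SmoothMap n l) (m : SmoothMap k n) (S : obj l),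
    map (s.comp m) S = map m (map s S)

/-- Smooth maps of smooth simplicial sets: natural transformations. -/
@[ext]
structure SmoothSSet.Hom (X : SmoothSSet.{w}) (Y : SmoothSSet.{w'}) where
  app : ∀ {n : ℕ}, X.obj n → Y.obj n
  naturality : ∀ {k n : ℕ} (s : SmoothMap k n) (S : X.obj n), app (X.map s S) = Y.map s (app S)

namespace SmoothSSet

/-- Composition `g ∘ f` of smooth maps. -/
def Hom.comp {X : SmoothSSet.{w}} {Y : SmoothSSet.{w'}} {Z : SmoothSSet.{w''}}
    (g : Hom Y Z) (f : Hom X Y) : Hom X Z where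
  app S := g.app (f.app S)
  naturality s S := by rw [f.naturality, g.naturality]

/-- The tautological smooth simplicial set `Δ^d_•`, whose `n`-simplices are the smooth maps
`Δ^n → Δ^d`. -/
def std (d : ℕ) : SmoothSSet.{0} where
  obj n := SmoothMap n d
  map s S := S.comp s
  map_id _ := rfl
  map_comp _ _ _ := rfl

/-- The map `σ_• : Δ^k_• → Δ^d_•` induced by a smooth map `σ : Δ^k → Δ^d`. -/
def stdMap {k d : ℕ} (s : SmoothMap k d) : Hom (std k) (std d) where
  app S := s.comp S
  naturality _ _ := rfl

/-- The smooth simplicial set `Y_•` of a manifold `Y`: its `n`-simplices are the smooth maps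
`Δ^n → Y`. -/
def sing {H : Type v} [NormedAddCommGroup H] [NormedSpace ℝ H] {B : Type w}
    [TopologicalSpace B] (I : ModelWithCorners ℝ H B) (Y : Type u) [TopologicalSpace Y]
    [ChartedSpace B Y] : SmoothSSet.{u} where
  obj n := {f : Simplex n → Y // SimplexSmooth I f}
  map s f := ⟨fun x => f.1 (s.toFun x), f.2.comp s⟩
  map_id _ := rfl
  map_comp _ _ _ := rfl

/-- The product of two smooth simplicial sets. -/
def prod (X : SmoothSSet.{w}) (Y : SmoothSSet.{w'}) : SmoothSSet.{max w w'} where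
  obj n := X.obj n × Y.obj n
  map s S := (X.map s S.1, Y.map s S.2)
  map_id S := by rw [X.map_id, Y.map_id]
  map_comp s m S := by rw [X.map_comp, Y.map_comp]

end SmoothSSet

open SmoothSSet (Hom)

/-- The vertex `0` of `Δ^1`. -/
def vertexZero : Simplex 1 := ⟨fun _ => 0, by simp [simplexSet]⟩

/-- The vertex `1` of `Δ^1`. -/
def vertexOne : Simplex 1 := ⟨fun _ => 1, by simp [simplexSet]⟩

/-- Two smooth maps `f, g : X → Y` are smoothly homotopic: there is a smooth map
`H : X × Δ^1_• → Y` that restricts to `f` on `X × 0_•` and to `g` on `X × 1_•`. The `n`-simplices of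
`0_•`, `1_•` are the constant maps from `Δ^n` to the vertices of `Δ^1`. -/
def SmoothlyHomotopic {X : SmoothSSet.{w}} {Y : SmoothSSet.{w'}} (f g : Hom X Y) : Prop :=
  ∃ H : Hom (X.prod (SmoothSSet.std 1)) Y, ∀ (n : ℕ) (S : X.obj n),
    H.app (n := n) (S, SmoothMap.const n vertexZero) = f.app S ∧
    H.app (n := n) (S, SmoothMap.const n vertexOne) = g.app S

/-! ### Smooth principal `G`-bundles over simplices -/

section Bundles

variable (E : Type v) [AddCommGroup E] [Module ℝ E] [TopologicalSpace E]
  (G : Type u) [TopologicalSpace G] [ChartedSpace E G] [Group G]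

/-- A smooth (principal, right) `G`-bundle over `Δ^n`: a topological principal `G`-bundle with a
maximal atlas of equivariant local trivializations whose transition functions are smooth maps from
open subsets of `Δ^n` to `G`. The total space belongs to the universe `Type u` that contains `G`. -/
structure GBundle (n : ℕ) where
  Total : Type u
  [topology : TopologicalSpace Total]
  proj : Total → Simplex n
  /-- the right action of `G` -/
  act : Total → G → Total
  act_one : ∀ p, act p 1 = p
  act_mul : ∀ p g h, act p (g * h) = act (act p g) h
  proj_act : ∀ p g, proj (act p g) = proj p
  /-- the smooth local trivializations -/
  triv : Set (Bundle.Trivialization G proj)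
  equivariant : ∀ e ∈ triv, ∀ p, proj p ∈ e.baseSet → ∀ g, (e (act p g)).2 = (e p).2 * g
  cover : ∀ x, ∃ e ∈ triv, x ∈ e.baseSet
  smooth_transition : ∀ e ∈ triv, ∀ e' ∈ triv,
    SimplexSmoothOnInto E (fun x => (e' (e.toOpenPartialHomeomorph.symm (x, 1))).2)
      (e.baseSet ∩ e'.baseSet)
  maximal : ∀ e : Bundle.Trivialization G proj,
    (∀ p, proj p ∈ e.baseSet → ∀ g, (e (act p g)).2 = (e p).2 * g) →
    (∀ e' ∈ triv,
      SimplexSmoothOnInto E (fun x => (e' (e.toOpenPartialHomeomorph.symm (x, 1))).2)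
        (e.baseSet ∩ e'.baseSet) ∧
      SimplexSmoothOnInto E (fun x => (e (e'.toOpenPartialHomeomorph.symm (x, 1))).2)
        (e'.baseSet ∩ e.baseSet)) →
    e ∈ triv

attribute [instance] GBundle.topology

variable {E G}

/-- A smooth `G`-bundle map `P → Q` over the smooth map `m : Δ^k → Δ^n`: an equivariant map over `m`
that is smooth in all smooth local trivializations. (In such trivializations it has the form
`(x, g) ↦ (m x, h x * g)`, with `h` the function below.) -/
@[ext]
structure GBundleMap {k n : ℕ} (m : SmoothMap k n) (P : GBundle E G k) (Q : GBundle E G n) where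
  toFun : P.Total → Q.Total
  proj_toFun : ∀ p, Q.proj (toFun p) = m.toFun (P.proj p)
  equivariant : ∀ p g, toFun (P.act p g) = Q.act (toFun p) g
  smooth : ∀ e ∈ P.triv, ∀ e' ∈ Q.triv,
    SimplexSmoothOnInto E (fun x => (e' (toFun (e.toOpenPartialHomeomorph.symm (x, 1)))).2)
      {x | x ∈ e.baseSet ∧ m.toFun x ∈ e'.baseSet}

/-! ### Simplicial `G`-bundles -/

variable (E G)

/-- A smooth simplicial `G`-bundle over `X`, small with respect to the universe `Type u`. It is a
functor from the category `Δ^sm(X)` to smooth `G`-bundles. An object of `Δ^sm(X)` is a simplex `S` of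
`X`, a morphism from the `k`-simplex `S` to the `n`-simplex `T` is a smooth map `m : Δ^k → Δ^n` with
`T_*(m) = S`. An `n`-simplex goes to a bundle over `Δ^n`, and `m` to a bundle map over `m`. -/
structure SimplicialGBundle (X : SmoothSSet.{w}) where
  obj : ∀ {n : ℕ}, X.obj n → GBundle E G n
  map : ∀ {k n : ℕ} (S : X.obj k) (T : X.obj n) (m : SmoothMap k n), X.map m T = S →
    GBundleMap m (obj S) (obj T)
  map_id : ∀ {n : ℕ} (S : X.obj n) (h : X.map (SmoothMap.id n) S = S) (p : (obj S).Total),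
    (map S S (SmoothMap.id n) h).toFun p = p
  map_comp : ∀ {k n l : ℕ} (R : X.obj k) (S : X.obj n) (T : X.obj l)
    (m : SmoothMap k n) (s : SmoothMap n l) (hm : X.map m S = R) (hs : X.map s T = S)
    (h : X.map (s.comp m) T = R) (p : (obj R).Total),
    (map R T (s.comp m) h).toFun p = (map S T s hs).toFun ((map R S m hm).toFun p)

variable {E G}

namespace SimplicialGBundle

/-- The pull-back `f^*P = P ∘ Δ^sm(f)` of a simplicial `G`-bundle by a smooth map. -/
def pullback {X : SmoothSSet.{w}} {Y : SmoothSSet.{w'}} (f : Hom X Y)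
    (P : SimplicialGBundle E G Y) : SimplicialGBundle E G X where
  obj S := P.obj (f.app S)
  map S T m h := P.map (f.app S) (f.app T) m (by rw [← f.naturality, h])
  map_id S h p := P.map_id _ _ p
  map_comp R S T m s hm hs h p := P.map_comp _ _ _ m s _ _ _ p

/-- An isomorphism (over the identity of `X`) of simplicial `G`-bundles: a natural transformation
that consists of bundle maps over the identities of the simplices, with an inverse of the same
kind. -/
structure Iso {X : SmoothSSet.{w}} (P Q : SimplicialGBundle E G X) where
  hom : ∀ {n : ℕ} (S : X.obj n), GBundleMap (SmoothMap.id n) (P.obj S) (Q.obj S)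
  inv : ∀ {n : ℕ} (S : X.obj n), GBundleMap (SmoothMap.id n) (Q.obj S) (P.obj S)
  hom_natural : ∀ {k n : ℕ} (S : X.obj k) (T : X.obj n) (m : SmoothMap k n) (h : X.map m T = S)
    (p : (P.obj S).Total),
    (hom T).toFun ((P.map S T m h).toFun p) = (Q.map S T m h).toFun ((hom S).toFun p)
  inv_natural : ∀ {k n : ℕ} (S : X.obj k) (T : X.obj n) (m : SmoothMap k n) (h : X.map m T = S)
    (q : (Q.obj S).Total),
    (inv T).toFun ((Q.map S T m h).toFun q) = (P.map S T m h).toFun ((inv S).toFun q)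
  inv_hom : ∀ {n : ℕ} (S : X.obj n) (p : (P.obj S).Total), (inv S).toFun ((hom S).toFun p) = p
  hom_inv : ∀ {n : ℕ} (S : X.obj n) (q : (Q.obj S).Total), (hom S).toFun ((inv S).toFun q) = q

/-- `P` and `Q` are isomorphic simplicial `G`-bundles. -/
def Isomorphic {X : SmoothSSet.{w}} (P Q : SimplicialGBundle E G X) : Prop := Nonempty (Iso P Q)

end SimplicialGBundle

/-! ### The classifying space and the universal bundle -/

variable (E G)

/-- The smooth simplicial set `BG^𝒰`, for the universe `𝒰 = Type u`. Its `n`-simplices are the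
`𝒰`-small simplicial `G`-bundles over `Δ^n_•`, and `P_*(σ) = (σ_•)^*P`. -/
def BG : SmoothSSet.{u + 1} where
  obj n := SimplicialGBundle E G (SmoothSSet.std n)
  map s P := P.pullback (SmoothSSet.stdMap s)
  map_id _ := rfl
  map_comp _ _ _ := rfl

/-- The value of the universal bundle on a morphism `m` from `S` to `T` in `Δ^sm(BG^𝒰)`: since
`S = (m_•)^*T`, the bundle `S(id)` is `T(m)`, and the bundle map to `T(id)` is the value of `T` at
the morphism `m` from the simplex `m` to the simplex `id` of `Δ^n_•`. -/
def EGMap {k n : ℕ} (S : (BG E G).obj k) (T : (BG E G).obj n) (m : SmoothMap k n)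
    (h : (BG E G).map m T = S) :
    GBundleMap m (SimplicialGBundle.obj S (SmoothMap.id k))
      (SimplicialGBundle.obj T (SmoothMap.id n)) :=
  match S, h with
  | _, rfl => SimplicialGBundle.map T m (SmoothMap.id n) m rfl

/-- The universal simplicial `G`-bundle `EG^𝒰` over `BG^𝒰`. Its value at a simplex of `BG^𝒰`, that
is at a simplicial `G`-bundle `P` over `Δ^n_•`, is `P(id)`. -/
def EG : SimplicialGBundle E G (BG E G) where
  obj P := SimplicialGBundle.obj P (SmoothMap.id _)
  map S T m h := EGMap E G S T m h
  map_id S _ p := SimplicialGBundle.map_id S _ _ p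
  map_comp R S T m s hm hs h p := by
    subst hs
    subst hm
    exact SimplicialGBundle.map_comp T (s.comp m) s (SmoothMap.id _) m s rfl rfl rfl p

variable {E G}

/-- The smooth map `f : X → BG^𝒰` classifies the simplicial `G`-bundle `P`: `f^*EG^𝒰` is isomorphic
to `P`. -/
def Classifies {X : SmoothSSet.{w}} (f : Hom X (BG E G)) (P : SimplicialGBundle E G X) : Prop :=
  ((EG E G).pullback f).Isomorphic P

end Bundles

end SmoothSimplicial

set_option linter.unusedSectionVars false

namespace SmoothSimplicial

/-! ### Calculus of `C^n` maps between locally convex spaces -/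

/-! Smooth maps `X → BG` are literally the same thing as simplicial bundles over `X`. A bundle `P`
gives `classifyingMap P`, which pulls `P` back along the map `Δ^n_• → X` of each simplex; a map `f`
gives `f^*EG`. These assignments are mutually inverse up to equality (`EG_pullback_classifyingMap`,
`classifyingMap_EG_pullback`), by the functor laws and naturality alone, and this yields claim 1.

For claim 2, a homotopy is then a bundle over `X × Δ^1_•` with prescribed restrictions to the ends.
A simplicial bundle is only a functor, so nothing ties its values on different simplices together
beyond the morphisms. Given an isomorphism between `P` and `Q`, one may use `P` on the pairs whose
second component is constant at vertex 0 and `Q` on all others, inserting the isomorphism whenever a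
morphism passes from one kind to the other (`SimplicialGBundle.mixed`).

For claim 3, a smooth step function pulls the homotopy back to the cylinder `Y × ℝ`, and the
restrictions of a bundle to heights 0 and 1 have to be compared (`cylinder_isomorphic`). No total
space over the cylinder is built. Instead, an arbitrary frame is chosen over every 0-simplex. All
morphisms preserve these frames, so sections over simplices become `G`-valued functions, and a
function of the points that sends smooth sections to smooth sections by left multiplication is an
isomorphism (`pullback_isomorphic`). Small open sets of the cylinder are parametrized by simplices,
hence carry smooth sections (`exists_smoothFrameOn_nhds`); gluing along the interval gives sections
over `V × [0,1]` (`exists_smoothFrameOn_prod`). A partition of unity subordinate to countably many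
such `V` cuts the way from height 0 to height 1 into steps, and on each step one transports along
one local section (`smoothFrameAt_transport`). The product is locally finite and gives the
isomorphism, with no connection or differential equation.

The calculus needed in the group is the chain rule `IsCk.comp`. It rests on a mean value estimate
obtained from Hahn–Banach separation. -/

theorem IsCk.continuousOn {n : ℕ} {E : Type u} {F : Type v} [AddCommGroup E] [Module ℝ E]
    [TopologicalSpace E] [AddCommGroup F] [Module ℝ F] [TopologicalSpace F] {f : E → F} {U : Set E}
    (h : IsCk n f U) : ContinuousOn f U := by
  cases n with
  | zero => exact h
  | succ n => exact h.1

theorem IsCk.mono {n : ℕ} : ∀ {E : Type u} {F : Type v} [AddCommGroup E] [Module ℝ E]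
    [TopologicalSpace E] [AddCommGroup F] [Module ℝ F] [TopologicalSpace F] {f : E → F}
    {U V : Set E}, IsCk n f U → V ⊆ U → IsCk n f V := by
  induction n with
  | zero => intro E F _ _ _ _ _ _ f U V h hV; exact ContinuousOn.mono h hV
  | succ n ih =>
    intro E F _ _ _ _ _ _ f U V h hV
    obtain ⟨hc, df, hd, hdf⟩ := h
    exact ⟨hc.mono hV, df, fun x hx => hd x (hV hx), ih hdf (Set.prod_mono hV subset_rfl)⟩

theorem IsCk.of_succ {n : ℕ} : ∀ {E : Type u} {F : Type v} [AddCommGroup E] [Module ℝ E]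
    [TopologicalSpace E] [AddCommGroup F] [Module ℝ F] [TopologicalSpace F] {f : E → F}
    {U : Set E}, IsCk (n + 1) f U → IsCk n f U := by
  induction n with
  | zero => intro E F _ _ _ _ _ _ f U h; exact h.1
  | succ n ih =>
    intro E F _ _ _ _ _ _ f U h
    obtain ⟨hc, df, hd, hdf⟩ := h
    exact ⟨hc, df, hd, ih hdf⟩

theorem eventually_add_smul_mem {E : Type u} [AddCommGroup E] [Module ℝ E] [TopologicalSpace E]
    [ContinuousAdd E] [ContinuousSMul ℝ E] {U : Set E} (hU : IsOpen U) {x : E} (hx : x ∈ U)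
    (h : E) : ∀ᶠ t : ℝ in 𝓝[≠] 0, x + t • h ∈ U := by
  have hc : Continuous fun t : ℝ => x + t • h := by fun_prop
  have : Filter.Tendsto (fun t : ℝ => x + t • h) (𝓝[≠] 0) (𝓝 x) := by
    have := hc.tendsto 0
    simp only [zero_smul, add_zero] at this
    exact this.mono_left nhdsWithin_le_nhds
  exact this (hU.mem_nhds hx)

theorem IsCk.congr {n : ℕ} {E : Type u} {F : Type v} [AddCommGroup E] [Module ℝ E]
    [TopologicalSpace E] [ContinuousAdd E] [ContinuousSMul ℝ E] [AddCommGroup F] [Module ℝ F]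
    [TopologicalSpace F] {f g : E → F} {U : Set E} (hU : IsOpen U) (h : IsCk n f U)
    (hfg : Set.EqOn f g U) : IsCk n g U := by
  cases n with
  | zero => exact ContinuousOn.congr h hfg.symm
  | succ n =>
    obtain ⟨hc, df, hd, hdf⟩ := h
    refine ⟨hc.congr hfg.symm, df, fun x hx v => (hd x hx v).congr' ?_, hdf⟩
    filter_upwards [eventually_add_smul_mem hU hx v] with t ht
    rw [hfg ht, hfg hx]

/-- Limits in a Hausdorff space are unique, so the directional derivatives supplied by the local
data agree on overlaps and form one global function, to which the induction applies. -/
theorem IsCk.of_locally {n : ℕ} : ∀ {E : Type u} {F : Type v} [AddCommGroup E] [Module ℝ E]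
    [TopologicalSpace E] [ContinuousAdd E] [ContinuousSMul ℝ E] [AddCommGroup F] [Module ℝ F]
    [TopologicalSpace F] [T2Space F] {f : E → F} {U : Set E}, IsOpen U →
    (∀ x ∈ U, ∃ W, IsOpen W ∧ x ∈ W ∧ IsCk n f (U ∩ W)) → IsCk n f U := by
  induction n with
  | zero =>
    intro E F _ _ _ _ _ _ _ _ _ f U hU h x hx
    obtain ⟨W, hW, hxW, hf⟩ := h x hx
    have hf' : ContinuousOn f (U ∩ W) := hf
    exact (hf'.continuousAt ((hU.inter hW).mem_nhds ⟨hx, hxW⟩)).continuousWithinAt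
  | succ n ih =>
    intro E F _ _ _ _ _ _ _ _ _ f U hU h
    have hlim : ∀ p : E × E, ∃ w : F, p.1 ∈ U →
        Filter.Tendsto (fun t : ℝ => t⁻¹ • (f (p.1 + t • p.2) - f p.1)) (𝓝[≠] 0) (𝓝 w) := by
      intro p
      by_cases hp : p.1 ∈ U
      · obtain ⟨W, hW, hxW, -, df, hd, -⟩ := h p.1 hp
        exact ⟨df (p.1, p.2), fun _ => hd p.1 ⟨hp, hxW⟩ p.2⟩
      · exact ⟨0, fun h => absurd h hp⟩
    choose df hdf using hlim
    refine ⟨fun x hx => ?_, df, fun x hx v => hdf (x, v) hx, ih (hU.prod isOpen_univ) ?_⟩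
    · obtain ⟨W, hW, hxW, hf, -⟩ := h x hx
      exact (hf.continuousAt ((hU.inter hW).mem_nhds ⟨hx, hxW⟩)).continuousWithinAt
    · intro p hp
      obtain ⟨W, hW, hxW, -, df', hd', hdf'⟩ := h p.1 hp.1
      refine ⟨W ×ˢ Set.univ, hW.prod isOpen_univ, ⟨hxW, trivial⟩, ?_⟩
      rw [Set.prod_inter_prod, Set.univ_inter]
      refine IsCk.congr ((hU.inter hW).prod isOpen_univ) hdf' ?_
      intro q hq
      exact tendsto_nhds_unique (hd' q.1 hq.1 q.2) (hdf q hq.1.1)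

/-- Mean value estimate: a difference quotient lies in every open convex set which contains the
directional derivatives along the segment. -/
theorem slope_mem_of_dirDeriv_mem {F : Type u} {H : Type v} [AddCommGroup F] [Module ℝ F]
    [TopologicalSpace F] [AddCommGroup H] [Module ℝ H]
    [TopologicalSpace H] [IsTopologicalAddGroup H] [ContinuousSMul ℝ H]
    {g : F → H} {x q : F} {dg : ℝ → H} {t : ℝ} (ht : t ≠ 0) {C : Set H}
    (hC : IsOpen C) (hCc : Convex ℝ C)
    (hd : ∀ r : ℝ, |r| ≤ |t| → Filter.Tendsto
      (fun s : ℝ => s⁻¹ • (g ((x + r • q) + s • q) - g (x + r • q))) (𝓝[≠] 0) (𝓝 (dg r)))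
    (hdC : ∀ r : ℝ, |r| ≤ |t| → dg r ∈ C) : t⁻¹ • (g (x + t • q) - g x) ∈ C := by
  by_contra hw
  -- A functional that separates the slope from `C` reduces the claim to the scalar mean value
  -- theorem for `l ∘ g` on the segment.
  obtain ⟨l, hl⟩ := geometric_hahn_banach_open_point hCc hC hw
  have hder : ∀ r : ℝ, |r| ≤ |t| → HasDerivAt (fun r => l (g (x + r • q))) (l (dg r)) r := by
    intro r hr
    rw [hasDerivAt_iff_tendsto_slope_zero]
    refine ((l.continuous.tendsto _).comp (hd r hr)).congr fun s => ?_
    simp only [Function.comp_apply, map_smul, map_sub, add_smul, add_assoc]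
  have key : ∃ r : ℝ, |r| ≤ |t| ∧ l (dg r) = l (t⁻¹ • (g (x + t • q) - g x)) := by
    rcases lt_or_gt_of_ne ht with h | h
    · obtain ⟨r, hr, he⟩ := exists_hasDerivAt_eq_slope (fun r => l (g (x + r • q)))
        (fun r => l (dg r)) h
        (fun r hr => (hder r (by
          rw [abs_of_nonpos hr.2, abs_of_neg h]; linarith [hr.1])).continuousAt.continuousWithinAt)
        (fun r hr => hder r (by
          rw [abs_of_neg hr.2, abs_of_neg h]; linarith [hr.1]))
      refine ⟨r, by rw [abs_of_neg hr.2, abs_of_neg h]; linarith [hr.1], he.trans ?_⟩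
      simp only [zero_smul, add_zero, map_smul, map_sub, smul_eq_mul]
      field_simp
      ring
    · obtain ⟨r, hr, he⟩ := exists_hasDerivAt_eq_slope (fun r => l (g (x + r • q)))
        (fun r => l (dg r)) h
        (fun r hr => (hder r (by
          rw [abs_of_nonneg hr.1, abs_of_pos h]; linarith [hr.2])).continuousAt.continuousWithinAt)
        (fun r hr => hder r (by
          rw [abs_of_pos hr.1, abs_of_pos h]; linarith [hr.2]))
      refine ⟨r, by rw [abs_of_pos hr.1, abs_of_pos h]; linarith [hr.2], he.trans ?_⟩
      simp only [zero_smul, add_zero, map_smul, map_sub, smul_eq_mul]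
      field_simp
      ring
  obtain ⟨r, hr, he⟩ := key
  exact absurd he (hl _ (hdC r hr)).ne

/-- A map with a continuous directional derivative has the Hadamard differentiability property. -/
theorem tendsto_slope_of_dirDeriv {F : Type u} {H : Type v} [AddCommGroup F] [Module ℝ F]
    [TopologicalSpace F] [ContinuousAdd F] [ContinuousSMul ℝ F] [AddCommGroup H] [Module ℝ H]
    [TopologicalSpace H] [IsTopologicalAddGroup H] [ContinuousSMul ℝ H] [LocallyConvexSpace ℝ H]
    {V : Set F} (hV : IsOpen V) {g : F → H} {dg : F × F → H}
    (hd : ∀ x ∈ V, ∀ h : F, Filter.Tendsto (fun t : ℝ => t⁻¹ • (g (x + t • h) - g x)) (𝓝[≠] 0)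
      (𝓝 (dg (x, h))))
    (hc : ContinuousOn dg (V ×ˢ Set.univ)) {x h : F} (hx : x ∈ V) {q : ℝ → F}
    (hq : Filter.Tendsto q (𝓝[≠] 0) (𝓝 h)) :
    Filter.Tendsto (fun t : ℝ => t⁻¹ • (g (x + t • q t) - g x)) (𝓝[≠] 0) (𝓝 (dg (x, h))) := by
  have hbasis : (𝓝 (dg (x, h))).HasBasis
      (fun s : Set H => (0 : H) ∈ s ∧ IsOpen s ∧ Convex ℝ s)
      (fun s => (fun w => w - dg (x, h)) ⁻¹' s) := by
    have := (LocallyConvexSpace.convex_open_basis_zero ℝ H).comap (fun w => w - dg (x, h))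
    rwa [nhds_translation_sub] at this
  rw [hbasis.tendsto_right_iff]
  rintro C₀ ⟨hC0, hCo, hCc⟩
  set C : Set H := (fun w => w - dg (x, h)) ⁻¹' C₀ with hCdef
  have hC : IsOpen C := hCo.preimage (by fun_prop)
  have hCconv : Convex ℝ C := by
    have : C = (fun w => (-dg (x, h)) + w) ⁻¹' C₀ := by
      ext w; simp [hCdef, sub_eq_neg_add]
    rw [this]
    exact hCc.translate_preimage_right _
  have hCmem : dg (x, h) ∈ C := by simpa [hCdef] using hC0
  have hopen : IsOpen (V ×ˢ (Set.univ : Set F)) := hV.prod isOpen_univ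
  have hcont : Filter.Tendsto (fun p : ℝ × F => (x + p.1 • p.2, p.2)) (𝓝 (0, h)) (𝓝 (x, h)) := by
    have : Continuous fun p : ℝ × F => (x + p.1 • p.2, p.2) := by fun_prop
    simpa using this.tendsto (0, h)
  -- Joint continuity of `dg` controls all small parameters and all directions near `h` at once.
  -- This uniformity allows the direction `q t` to vary with `t`.
  have hgood : ∀ᶠ p in 𝓝 ((0 : ℝ), h),
      x + p.1 • p.2 ∈ V ∧ dg (x + p.1 • p.2, p.2) ∈ C := by
    have h1 : ∀ᶠ z in 𝓝 (x, h), z.1 ∈ V ∧ dg z ∈ C :=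
      ((hopen.eventually_mem ⟨hx, trivial⟩).mono fun z hz => hz.1).and
        ((hc.continuousAt (hopen.mem_nhds ⟨hx, trivial⟩)) (hC.mem_nhds hCmem))
    exact hcont.eventually h1
  rw [nhds_prod_eq] at hgood
  obtain ⟨pa, ha, pb, hb, hab⟩ := Filter.eventually_prod_iff.1 hgood
  obtain ⟨δ, hδ, hball⟩ := Metric.eventually_nhds_iff.1 ha
  filter_upwards [hq.eventually hb, self_mem_nhdsWithin,
    nhdsWithin_le_nhds (Metric.ball_mem_nhds (0 : ℝ) hδ)] with t hbt ht0 htδ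
  have hr : ∀ r : ℝ, |r| ≤ |t| → x + r • q t ∈ V ∧ dg (x + r • q t, q t) ∈ C := by
    intro r hr
    refine hab (hball ?_) hbt
    rw [Metric.mem_ball, dist_zero_right, Real.norm_eq_abs] at htδ
    rw [dist_zero_right, Real.norm_eq_abs]
    linarith
  exact slope_mem_of_dirDeriv_mem ht0 hC hCconv (fun r hr' => hd _ (hr r hr').1 (q t))
    (fun r hr' => (hr r hr').2)

theorem IsCk.prodMk {n : ℕ} : ∀ {E : Type u} {F : Type v} {H : Type w} [AddCommGroup E] [Module ℝ E]
    [TopologicalSpace E] [AddCommGroup F] [Module ℝ F] [TopologicalSpace F] [AddCommGroup H]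
    [Module ℝ H] [TopologicalSpace H] {f : E → F} {g : E → H} {U : Set E},
    IsCk n f U → IsCk n g U → IsCk n (fun x => (f x, g x)) U := by
  induction n with
  | zero => intro E F H _ _ _ _ _ _ _ _ _ f g U hf hg; exact ContinuousOn.prodMk hf hg
  | succ n ih =>
    intro E F H _ _ _ _ _ _ _ _ _ f g U hf hg
    obtain ⟨hfc, df, hfd, hdf⟩ := hf
    obtain ⟨hgc, dg, hgd, hdg⟩ := hg
    exact ⟨hfc.prodMk hgc, fun p => (df p, dg p),
      fun x hx h => (hfd x hx h).prodMk_nhds (hgd x hx h), ih hdf hdg⟩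

theorem IsCk.const {n : ℕ} : ∀ {E : Type u} {F : Type v} [AddCommGroup E] [Module ℝ E]
    [TopologicalSpace E] [AddCommGroup F] [Module ℝ F] [TopologicalSpace F]
    (c : F) (U : Set E), IsCk n (fun _ => c) U := by
  induction n with
  | zero => intro E F _ _ _ _ _ _ c U; exact continuousOn_const
  | succ n ih =>
    intro E F _ _ _ _ _ _ c U
    exact ⟨continuousOn_const, fun _ => 0, fun x _ h => by simpa using tendsto_const_nhds, ih _ _⟩

/-- The chain rule needs this for the first projection. Linearity makes it direct, without local
convexity of the target or openness of the domain. -/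
theorem IsCk.comp_clm {n : ℕ} : ∀ {E : Type u} {F : Type v} {H : Type w} [AddCommGroup E]
    [Module ℝ E] [TopologicalSpace E] [AddCommGroup F] [Module ℝ F] [TopologicalSpace F]
    [AddCommGroup H] [Module ℝ H] [TopologicalSpace H] {f : F → H} {U : Set F} {V : Set E},
    IsCk n f U → ∀ l : E →L[ℝ] F, Set.MapsTo l V U → IsCk n (fun x => f (l x)) V := by
  induction n with
  | zero =>
    intro E F H _ _ _ _ _ _ _ _ _ f U V hf l hl
    exact ContinuousOn.comp hf l.continuous.continuousOn hl
  | succ n ih =>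
    intro E F H _ _ _ _ _ _ _ _ _ f U V hf l hl
    obtain ⟨hfc, df, hd, hdf⟩ := hf
    refine ⟨hfc.comp l.continuous.continuousOn hl, fun p => df (l p.1, l p.2), fun x hx h => ?_,
      ih hdf (l.prodMap l) fun p hp => ⟨hl hp.1, trivial⟩⟩
    simpa using hd (l x) (hl hx) (l h)

/-- The chain rule. -/
theorem IsCk.comp {n : ℕ} : ∀ {E : Type u} {F : Type v} {H : Type w} [AddCommGroup E] [Module ℝ E]
    [TopologicalSpace E] [AddCommGroup F] [Module ℝ F] [TopologicalSpace F] [ContinuousAdd F]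
    [ContinuousSMul ℝ F] [AddCommGroup H] [Module ℝ H] [TopologicalSpace H]
    [IsTopologicalAddGroup H] [ContinuousSMul ℝ H] [LocallyConvexSpace ℝ H]
    {g : F → H} {f : E → F} {U : Set E} {V : Set F}, IsOpen V →
    IsCk n g V → IsCk n f U → Set.MapsTo f U V → IsCk n (fun x => g (f x)) U := by
  induction n with
  | zero =>
    intro E F H _ _ _ _ _ _ _ _ _ _ _ _ _ _ g f U V _ hg hf hm
    exact ContinuousOn.comp hg hf hm
  | succ n ih =>
    intro E F H _ _ _ _ _ _ _ _ _ _ _ _ _ _ g f U V hV hg hf hm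
    have hfn := hf.of_succ
    obtain ⟨hfc, df, hfd, hdf⟩ := hf
    obtain ⟨hgc, dg, hgd, hdg⟩ := hg
    refine ⟨hgc.comp hfc hm, fun p => dg (f p.1, df p), fun x hx h => ?_, ?_⟩
    -- The varying direction is the difference quotient of `f`, so that `f x + t • q t = f (x + t •
    -- h)` for `t ≠ 0`.
    · refine (tendsto_slope_of_dirDeriv hV hgd hdg.continuousOn (hm hx) (hfd x hx h)).congr' ?_
      filter_upwards [self_mem_nhdsWithin] with t ht
      have ht' : t ≠ 0 := ht
      simp [smul_smul, mul_inv_cancel₀ ht']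
    · refine ih (V := V ×ˢ Set.univ) (hV.prod isOpen_univ) hdg (IsCk.prodMk ?_ hdf)
        fun p hp => ⟨hm hp.1, trivial⟩
      exact hfn.comp_clm (ContinuousLinearMap.fst ℝ E E) fun p hp => hp.1

theorem isCk_of_contDiffOn {n : ℕ} : ∀ {E : Type u} {F : Type v} [NormedAddCommGroup E]
    [NormedSpace ℝ E] [NormedAddCommGroup F] [NormedSpace ℝ F] {f : E → F} {U : Set E},
    IsOpen U → ContDiffOn ℝ ∞ f U → IsCk n f U := by
  induction n with
  | zero => intro E F _ _ _ _ f U _ h; exact h.continuousOn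
  | succ n ih =>
    intro E F _ _ _ _ f U hU h
    refine ⟨h.continuousOn, fun p => fderiv ℝ f p.1 p.2, fun x hx v => ?_,
      ih (hU.prod isOpen_univ) ?_⟩
    · have hd : HasFDerivAt f (fderiv ℝ f x) x :=
        ((h.differentiableOn (by simp)).differentiableAt (hU.mem_nhds hx)).hasFDerivAt
      have := hd.hasLineDerivAt v
      rw [HasLineDerivAt, hasDerivAt_iff_tendsto_slope_zero] at this
      simpa using this
    · have h1 : ContDiffOn ℝ ∞ (fderiv ℝ f) U := h.fderiv_of_isOpen hU (by simp)
      exact (h1.comp contDiffOn_fst fun p hp => hp.1).clm_apply contDiffOn_snd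

/-! ### Smooth maps into a Fréchet Lie group -/

section IntoGroup

variable {E : Type v} [AddCommGroup E] [Module ℝ E] [TopologicalSpace E]
  {G : Type u} [TopologicalSpace G] [ChartedSpace E G]

theorem SmoothOnInto.isOpen_inter {n : ℕ} {h : (Fin n → ℝ) → G} {V : Set (Fin n → ℝ)}
    (hh : SmoothOnInto E h V) (hV : IsOpen V) (a : OpenPartialHomeomorph G E) :
    IsOpen {x | x ∈ V ∧ h x ∈ a.source} :=
  hh.1.isOpen_inter_preimage hV a.open_source

theorem SmoothOnInto.mono {n : ℕ} {h : (Fin n → ℝ) → G} {V W : Set (Fin n → ℝ)}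
    (hh : SmoothOnInto E h V) (hW : W ⊆ V) : SmoothOnInto E h W :=
  ⟨hh.1.mono hW, fun a ha k => (hh.2 a ha k).mono fun _ hx => ⟨hW hx.1, hx.2⟩⟩

variable (E) in
theorem SmoothOnInto.const {n : ℕ} (c : G) (V : Set (Fin n → ℝ)) :
    SmoothOnInto E (fun _ => c) V :=
  ⟨continuousOn_const, fun _ _ _ => IsCk.const _ _⟩

variable [IsTopologicalAddGroup E] [ContinuousSMul ℝ E] [LocallyConvexSpace ℝ E]

theorem SmoothOnInto.comp {k n : ℕ} {h : (Fin n → ℝ) → G} {V : Set (Fin n → ℝ)}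
    (hh : SmoothOnInto E h V) (hV : IsOpen V) {m : (Fin k → ℝ) → (Fin n → ℝ)}
    {W : Set (Fin k → ℝ)} (hW : IsOpen W) (hm : ContDiffOn ℝ ∞ m W) (hWV : Set.MapsTo m W V) :
    SmoothOnInto E (fun x => h (m x)) W := by
  refine ⟨hh.1.comp hm.continuousOn hWV, fun a ha j => ?_⟩
  exact IsCk.comp (g := fun z => a (h z)) (hh.isOpen_inter hV a) (hh.2 a ha j)
    ((isCk_of_contDiffOn hW hm).mono fun x hx => hx.1) fun x hx => ⟨hWV hx.1, hx.2⟩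

variable [T2Space E] [Group G] [IsFrechetLieGroup E G]

/-- Smoothness may be checked locally, in one chart around each point of the image. -/
theorem SmoothOnInto.of_charts {n : ℕ} {h : (Fin n → ℝ) → G} {V : Set (Fin n → ℝ)}
    (hV : IsOpen V) (hc : ContinuousOn h V)
    (H : ∀ x ∈ V, ∃ W, IsOpen W ∧ x ∈ W ∧ W ⊆ V ∧ ∃ a ∈ atlas E G, Set.MapsTo h W a.source ∧
      IsSmoothOn (fun y => a (h y)) W) : SmoothOnInto E h V := by
  refine ⟨hc, fun b hb k => ?_⟩
  have hU : IsOpen {x | x ∈ V ∧ h x ∈ b.source} := hc.isOpen_inter_preimage hV b.open_source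
  refine IsCk.of_locally hU fun x hx => ?_
  obtain ⟨W, hW, hxW, -, a, ha, hWa, hs⟩ := H x hx.1
  refine ⟨W, hW, hxW, ?_⟩
  have hop : IsOpen {x : E | x ∈ a.target ∧ a.symm x ∈ b.source} :=
    a.symm.continuousOn.isOpen_inter_preimage a.open_target b.open_source
  refine IsCk.congr (hU.inter hW) (IsCk.comp hop (IsFrechetLieGroup.smooth_charts a ha b hb k)
    ((hs k).mono Set.inter_subset_right) ?_) ?_
  · intro y hy
    refine ⟨a.map_source (hWa hy.2), ?_⟩
    rw [a.left_inv (hWa hy.2)]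
    exact hy.1.2
  · intro y hy
    simp only [a.left_inv (hWa hy.2)]

theorem SmoothOnInto.mul {n : ℕ} {h₁ h₂ : (Fin n → ℝ) → G} {V : Set (Fin n → ℝ)}
    (hV : IsOpen V) (H₁ : SmoothOnInto E h₁ V) (H₂ : SmoothOnInto E h₂ V) :
    SmoothOnInto E (fun x => h₁ x * h₂ x) V := by
  have := IsFrechetLieGroup.toIsTopologicalGroup (E := E) (G := G)
  have hc : ContinuousOn (fun x => h₁ x * h₂ x) V := H₁.1.mul H₂.1
  refine SmoothOnInto.of_charts hV hc fun x hx => ?_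
  set a := chartAt E (h₁ x)
  set b := chartAt E (h₂ x)
  set c := chartAt E (h₁ x * h₂ x)
  have ha : a ∈ atlas E G := chart_mem_atlas E _
  have hb : b ∈ atlas E G := chart_mem_atlas E _
  have hcc : c ∈ atlas E G := chart_mem_atlas E _
  have hab : IsOpen (({y | y ∈ V ∧ h₁ y ∈ a.source} ∩ {y | y ∈ V ∧ h₂ y ∈ b.source}) ∩
      {y | y ∈ V ∧ h₁ y * h₂ y ∈ c.source}) :=
    ((H₁.isOpen_inter hV a).inter (H₂.isOpen_inter hV b)).inter
      (hc.isOpen_inter_preimage hV c.open_source)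
  refine ⟨_, hab, ⟨⟨⟨hx, mem_chart_source E _⟩, hx, mem_chart_source E _⟩, hx,
    mem_chart_source E _⟩, fun y hy => hy.2.1, c, hcc, fun y hy => hy.2.2, fun k => ?_⟩
  have hop : IsOpen {x : E × E | x.1 ∈ a.target ∧ x.2 ∈ b.target ∧
      a.symm x.1 * b.symm x.2 ∈ c.source} := by
    have h1 : ContinuousOn (fun x : E × E => a.symm x.1 * b.symm x.2) (a.target ×ˢ b.target) :=
      (a.symm.continuousOn.comp continuousOn_fst fun p hp => hp.1).mul
        (b.symm.continuousOn.comp continuousOn_snd fun p hp => hp.2)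
    have h2 := h1.isOpen_inter_preimage (a.open_target.prod b.open_target) c.open_source
    convert h2 using 1
    ext p
    simp [and_assoc]
  refine IsCk.congr hab (IsCk.comp hop (IsFrechetLieGroup.smooth_mul a ha b hb c hcc k)
    (IsCk.prodMk ((H₁.2 a ha k).mono fun y hy => hy.1.1) ((H₂.2 b hb k).mono fun y hy => hy.1.2))
    ?_) ?_
  · intro y hy
    refine ⟨a.map_source hy.1.1.2, b.map_source hy.1.2.2, ?_⟩
    simp only [a.left_inv hy.1.1.2, b.left_inv hy.1.2.2]
    exact hy.2.2
  · intro y hy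
    simp only [a.left_inv hy.1.1.2, b.left_inv hy.1.2.2]

theorem SmoothOnInto.inv {n : ℕ} {h : (Fin n → ℝ) → G} {V : Set (Fin n → ℝ)}
    (hV : IsOpen V) (H : SmoothOnInto E h V) : SmoothOnInto E (fun x => (h x)⁻¹) V := by
  have := IsFrechetLieGroup.toIsTopologicalGroup (E := E) (G := G)
  have hc : ContinuousOn (fun x => (h x)⁻¹) V := H.1.inv
  refine SmoothOnInto.of_charts hV hc fun x hx => ?_
  set a := chartAt E (h x)
  set b := chartAt E (h x)⁻¹
  have ha : a ∈ atlas E G := chart_mem_atlas E _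
  have hb : b ∈ atlas E G := chart_mem_atlas E _
  have hab : IsOpen ({y | y ∈ V ∧ h y ∈ a.source} ∩ {y | y ∈ V ∧ (h y)⁻¹ ∈ b.source}) :=
    (H.isOpen_inter hV a).inter (hc.isOpen_inter_preimage hV b.open_source)
  refine ⟨_, hab, ⟨⟨hx, mem_chart_source E _⟩, hx, mem_chart_source E _⟩,
    fun y hy => hy.2.1, b, hb, fun y hy => hy.2.2, fun k => ?_⟩
  have hop : IsOpen {x : E | x ∈ a.target ∧ (a.symm x)⁻¹ ∈ b.source} :=
    a.symm.continuousOn.inv.isOpen_inter_preimage a.open_target b.open_source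
  refine IsCk.congr hab (IsCk.comp hop (IsFrechetLieGroup.smooth_inv a ha b hb k)
    ((H.2 a ha k).mono fun y hy => hy.1) ?_) ?_
  · intro y hy
    refine ⟨a.map_source hy.1.2, ?_⟩
    simp only [a.left_inv hy.1.2]
    exact hy.2.2
  · intro y hy
    simp only [a.left_inv hy.1.2]

end IntoGroup

/-! ### Germs of smooth maps from simplices to a Fréchet Lie group -/

section Germs

variable (E : Type v) [AddCommGroup E] [Module ℝ E] [TopologicalSpace E]
  {G : Type u} [TopologicalSpace G] [ChartedSpace E G]

/-- `h` extends smoothly to a neighbourhood of `x` in the coordinate space. -/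
def SmoothGermAt {n : ℕ} (h : Simplex n → G) (x : Simplex n) : Prop :=
  ∃ (V : Set (Fin n → ℝ)) (F : (Fin n → ℝ) → G), IsOpen V ∧ x.1 ∈ V ∧
    SmoothOnInto E F V ∧ ∀ y : Simplex n, y.1 ∈ V → F y.1 = h y

variable {E}

theorem exists_open_of_mem_nhds_simplex {n : ℕ} {x : Simplex n} {U : Set (Simplex n)}
    (hU : U ∈ 𝓝 x) :
    ∃ W : Set (Fin n → ℝ), IsOpen W ∧ x.1 ∈ W ∧ ∀ y : Simplex n, y.1 ∈ W → y ∈ U := by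
  obtain ⟨O, hOU, hO, hxO⟩ := mem_nhds_iff.1 hU
  obtain ⟨W, hW, rfl⟩ := isOpen_induced_iff.1 hO
  exact ⟨W, hW, hxO, fun y hy => hOU hy⟩

/-- When `U` is open in the simplex, the domain of an extension can be shrunk until it meets the
simplex inside `U`; smoothness is then a condition on germs. -/
theorem simplexSmoothOnInto_iff {n : ℕ} {h : Simplex n → G} {U : Set (Simplex n)}
    (hU : IsOpen U) : SimplexSmoothOnInto E h U ↔ ∀ x ∈ U, SmoothGermAt E h x := by
  constructor
  · intro H x hx
    obtain ⟨V, F, hV, hxV, hF, hFh⟩ := H x hx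
    obtain ⟨W, hW, hxW, hWU⟩ := exists_open_of_mem_nhds_simplex (hU.mem_nhds hx)
    exact ⟨V ∩ W, F, hV.inter hW, ⟨hxV, hxW⟩, hF.mono Set.inter_subset_left,
      fun y hy => hFh y (hWU y hy.2) hy.1⟩
  · intro H x hx
    obtain ⟨V, F, hV, hxV, hF, hFh⟩ := H x hx
    exact ⟨V, F, hV, hxV, hF, fun y _ hy => hFh y hy⟩

theorem SmoothGermAt.congr {n : ℕ} {h h' : Simplex n → G} {x : Simplex n}
    (H : SmoothGermAt E h x) (hh : ∀ᶠ y in 𝓝 x, h y = h' y) : SmoothGermAt E h' x := by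
  obtain ⟨V, F, hV, hxV, hF, hFh⟩ := H
  obtain ⟨W, hW, hxW, hWU⟩ := exists_open_of_mem_nhds_simplex hh
  exact ⟨V ∩ W, F, hV.inter hW, ⟨hxV, hxW⟩, hF.mono Set.inter_subset_left,
    fun y hy => (hFh y hy.1).trans (hWU y hy.2)⟩

theorem SmoothGermAt.eventually {n : ℕ} {h : Simplex n → G} {x : Simplex n}
    (H : SmoothGermAt E h x) : ∀ᶠ y in 𝓝 x, SmoothGermAt E h y := by
  obtain ⟨V, F, hV, hxV, hF, hFh⟩ := H
  filter_upwards [(hV.preimage continuous_subtype_val).mem_nhds hxV] with y hy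
  exact ⟨V, F, hV, hy, hF, hFh⟩

variable (E) in
theorem SmoothGermAt.const {n : ℕ} (c : G) (x : Simplex n) : SmoothGermAt E (fun _ => c) x :=
  ⟨Set.univ, fun _ => c, isOpen_univ, trivial, SmoothOnInto.const E c _, fun _ _ => rfl⟩

theorem SimplexSmooth.continuous {H : Type v} [NormedAddCommGroup H] [NormedSpace ℝ H] {B : Type w}
    [TopologicalSpace B] {I : ModelWithCorners ℝ H B} {M : Type u} [TopologicalSpace M]
    [ChartedSpace B M] {k : ℕ} {f : Simplex k → M} (hf : SimplexSmooth I f) : Continuous f := by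
  rw [continuous_iff_continuousAt]
  intro x
  obtain ⟨V, F, hV, hxV, hF, hFf⟩ := hf x
  have h1 : ContinuousAt (fun y : Simplex k => F y.1) x :=
    ContinuousAt.comp (hF.continuousOn.continuousAt (hV.mem_nhds hxV)) continuousAt_subtype_val
  refine h1.congr ?_
  filter_upwards [(hV.preimage continuous_subtype_val).mem_nhds hxV] with y hy
  exact hFf y hy

theorem SmoothMap.continuous {k n : ℕ} (m : SmoothMap k n) : Continuous m.toFun :=
  Continuous.subtype_mk m.smooth.continuous _

variable [IsTopologicalAddGroup E] [ContinuousSMul ℝ E] [LocallyConvexSpace ℝ E]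

theorem SmoothGermAt.comp {k n : ℕ} {h : Simplex n → G} (m : SmoothMap k n) {x : Simplex k}
    (H : SmoothGermAt E h (m.toFun x)) : SmoothGermAt E (fun y => h (m.toFun y)) x := by
  obtain ⟨V, F, hV, hxV, hF, hFh⟩ := H
  obtain ⟨W, M, hW, hxW, hM, hMm⟩ := m.smooth x
  rw [contMDiffOn_iff_contDiffOn] at hM
  have hop : IsOpen (W ∩ M ⁻¹' V) := hM.continuousOn.isOpen_inter_preimage hW hV
  refine ⟨W ∩ M ⁻¹' V, fun y => F (M y), hop, ⟨hxW, ?_⟩,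
    hF.comp hV hop (hM.mono Set.inter_subset_left) fun y hy => hy.2, ?_⟩
  · rw [Set.mem_preimage, hMm x hxW]
    exact hxV
  · intro y hy
    have h1 : M y.1 = (m.toFun y).1 := hMm y hy.1
    have h2 : M y.1 ∈ V := hy.2
    change F (M y.1) = _
    rw [h1] at h2 ⊢
    exact hFh _ h2

variable [T2Space E] [Group G] [IsFrechetLieGroup E G]

theorem SmoothGermAt.mul {n : ℕ} {h h' : Simplex n → G} {x : Simplex n}
    (H : SmoothGermAt E h x) (H' : SmoothGermAt E h' x) :
    SmoothGermAt E (fun y => h y * h' y) x := by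
  obtain ⟨V, F, hV, hxV, hF, hFh⟩ := H
  obtain ⟨V', F', hV', hxV', hF', hFh'⟩ := H'
  refine ⟨V ∩ V', fun y => F y * F' y, hV.inter hV', ⟨hxV, hxV'⟩,
    SmoothOnInto.mul (hV.inter hV') (hF.mono Set.inter_subset_left)
      (hF'.mono Set.inter_subset_right), fun y hy => congrArg₂ _ (hFh y hy.1) (hFh' y hy.2)⟩

theorem SmoothGermAt.inv {n : ℕ} {h : Simplex n → G} {x : Simplex n}
    (H : SmoothGermAt E h x) : SmoothGermAt E (fun y => (h y)⁻¹) x := by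
  obtain ⟨V, F, hV, hxV, hF, hFh⟩ := H
  exact ⟨V, fun y => (F y)⁻¹, hV, hxV, hF.inv hV, fun y hy => congrArg _ (hFh y hy)⟩

end Germs

/-! ### Smooth sections of principal bundles and bundle maps -/

section Sections

variable {E : Type v} [AddCommGroup E] [Module ℝ E] [TopologicalSpace E]
  {G : Type u} [TopologicalSpace G] [ChartedSpace E G] [Group G]

namespace GBundle

variable {n : ℕ} (P : GBundle E G n)

theorem eq_of_triv_eq {e : Bundle.Trivialization G P.proj} {p q : P.Total}
    (hp : P.proj p ∈ e.baseSet) (hpq : P.proj p = P.proj q) (h : (e p).2 = (e q).2) : p = q := by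
  have hp' : p ∈ e.source := e.mem_source.2 hp
  have hq' : q ∈ e.source := e.mem_source.2 (hpq ▸ hp)
  refine e.injOn hp' hq' (Prod.ext ?_ h)
  exact (e.coe_fst hp').trans (hpq.trans (e.coe_fst hq').symm)

theorem act_injective (p : P.Total) {g g' : G} (h : P.act p g = P.act p g') : g = g' := by
  obtain ⟨e, he, hx⟩ := P.cover (P.proj p)
  have h1 := P.equivariant e he p hx g
  rw [h, P.equivariant e he p hx g'] at h1
  exact (mul_left_cancel h1).symm

theorem exists_act_eq {p q : P.Total} (h : P.proj p = P.proj q) : ∃ g, P.act p g = q := by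
  obtain ⟨e, he, hx⟩ := P.cover (P.proj p)
  refine ⟨(e p).2⁻¹ * (e q).2, P.eq_of_triv_eq (e := e) ?_ ?_ ?_⟩
  · rwa [P.proj_act]
  · rw [P.proj_act, h]
  · rw [P.equivariant e he p hx, mul_inv_cancel_left]

theorem exists_proj_eq (x : Simplex n) : ∃ p, P.proj p = x := by
  obtain ⟨e, he, hx⟩ := P.cover x
  exact ⟨e.toOpenPartialHomeomorph.symm (x, 1), e.proj_symm_apply' hx⟩

/-- The map `s` into the total space lies over the smooth map `m`, and is smooth at `x`. -/
def SmoothAlong {k n : ℕ} (P : GBundle E G n) (m : SmoothMap k n) (s : Simplex k → P.Total)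
    (x : Simplex k) : Prop :=
  (∀ᶠ y in 𝓝 x, P.proj (s y) = m.toFun y) ∧
    ∃ e ∈ P.triv, m.toFun x ∈ e.baseSet ∧ SmoothGermAt E (fun y => (e (s y)).2) x

variable {P}

theorem eventually_mem_baseSet {k : ℕ} (m : SmoothMap k n) (e : Bundle.Trivialization G P.proj)
    {x : Simplex k} (hx : m.toFun x ∈ e.baseSet) : ∀ᶠ y in 𝓝 x, m.toFun y ∈ e.baseSet :=
  (e.open_baseSet.preimage m.continuous).mem_nhds hx

theorem SmoothAlong.congr {k : ℕ} {m m' : SmoothMap k n} {s s' : Simplex k → P.Total}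
    {x : Simplex k} (h : SmoothAlong P m s x) (hm : ∀ᶠ y in 𝓝 x, m.toFun y = m'.toFun y)
    (hs : ∀ᶠ y in 𝓝 x, s y = s' y) : SmoothAlong P m' s' x := by
  obtain ⟨h1, e, he, hx, h2⟩ := h
  refine ⟨?_, e, he, hm.self_of_nhds ▸ hx, h2.congr ?_⟩
  · filter_upwards [h1, hm, hs] with y a b c
    rw [← c, a, b]
  · filter_upwards [hs] with y c
    rw [c]

theorem SmoothAlong.eventually {k : ℕ} {m : SmoothMap k n} {s : Simplex k → P.Total}
    {x : Simplex k} (h : SmoothAlong P m s x) : ∀ᶠ y in 𝓝 x, SmoothAlong P m s y := by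
  obtain ⟨h1, e, he, hx, h2⟩ := h
  filter_upwards [h1.eventually_nhds, h2.eventually, eventually_mem_baseSet m e hx] with y a b c
  exact ⟨a, e, he, c, b⟩

theorem smoothAlong_symm {e : Bundle.Trivialization G P.proj} (he : e ∈ P.triv) {x : Simplex n}
    (hx : x ∈ e.baseSet) :
    SmoothAlong P (SmoothMap.id n) (fun y => e.toOpenPartialHomeomorph.symm (y, 1)) x := by
  have hb : ∀ᶠ y in 𝓝 x, y ∈ e.baseSet := e.open_baseSet.mem_nhds hx
  refine ⟨hb.mono fun y hy => e.proj_symm_apply' hy, e, he, hx,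
    (SmoothGermAt.const E 1 x).congr (hb.mono fun y hy => ?_)⟩
  have h : e (e.toOpenPartialHomeomorph.symm (y, 1)) = (y, 1) := e.apply_symm_apply' hy
  rw [h]

end GBundle

namespace GBundleMap

/-- The form of a bundle map in local trivializations. -/
theorem triv_toFun {k n : ℕ} {m : SmoothMap k n} {P : GBundle E G k} {Q : GBundle E G n}
    (f : GBundleMap m P Q) {e : Bundle.Trivialization G P.proj} (he : e ∈ P.triv)
    {e' : Bundle.Trivialization G Q.proj} (he' : e' ∈ Q.triv) (p : P.Total)
    (hp : P.proj p ∈ e.baseSet) (hp' : m.toFun (P.proj p) ∈ e'.baseSet) :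
    (e' (f.toFun p)).2 =
      (e' (f.toFun (e.toOpenPartialHomeomorph.symm (P.proj p, 1)))).2 * (e p).2 := by
  have h0 : P.proj (e.toOpenPartialHomeomorph.symm (P.proj p, (1 : G))) = P.proj p :=
    e.proj_symm_apply' hp
  have h1 : e (e.toOpenPartialHomeomorph.symm (P.proj p, 1)) = (P.proj p, 1) :=
    e.apply_symm_apply' hp
  have h2 : P.act (e.toOpenPartialHomeomorph.symm (P.proj p, 1)) (e p).2 = p := by
    refine P.eq_of_triv_eq (e := e) ?_ ?_ ?_
    · rwa [P.proj_act, h0]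
    · rw [P.proj_act, h0]
    · rw [P.equivariant e he _ (by rwa [h0]), h1, one_mul]
  conv_lhs => rw [← h2, f.equivariant]
  rw [Q.equivariant e' he' _ (by rwa [f.proj_toFun, h0])]

/-- The identity bundle map. -/
def id {n : ℕ} (P : GBundle E G n) : GBundleMap (SmoothMap.id n) P P where
  toFun p := p
  proj_toFun _ := rfl
  equivariant _ _ := rfl
  smooth := P.smooth_transition

variable [IsTopologicalAddGroup E] [ContinuousSMul ℝ E] [LocallyConvexSpace ℝ E]
  [T2Space E] [IsFrechetLieGroup E G]

/-- In trivializations a bundle map is left multiplication by a smooth `G`-valued function, so the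
new coordinate is a product of two smooth germs. -/
theorem smoothGermAt_triv_toFun {j k n : ℕ} {m : SmoothMap k n} {P : GBundle E G k}
    {Q : GBundle E G n} (f : GBundleMap m P Q) {r : SmoothMap j k} {s : Simplex j → P.Total}
    {x : Simplex j} (hs : P.SmoothAlong r s x) {e' : Bundle.Trivialization G Q.proj}
    (he' : e' ∈ Q.triv) (hx : m.toFun (r.toFun x) ∈ e'.baseSet) :
    SmoothGermAt E (fun y => (e' (f.toFun (s y))).2) x := by
  obtain ⟨h1, e, he, hxe, h2⟩ := hs
  have hop : IsOpen {x | x ∈ e.baseSet ∧ m.toFun x ∈ e'.baseSet} :=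
    e.open_baseSet.inter (e'.open_baseSet.preimage m.continuous)
  have h3 := (simplexSmoothOnInto_iff hop).1 (f.smooth e he e' he') _ ⟨hxe, hx⟩
  refine ((h3.comp r).mul h2).congr ?_
  filter_upwards [h1, GBundle.eventually_mem_baseSet r e hxe,
    GBundle.eventually_mem_baseSet (m.comp r) e' hx] with y a b c
  rw [f.triv_toFun he he' (s y) (by rwa [a]) (by rwa [a]), a]

theorem smoothAlong {j k n : ℕ} {m : SmoothMap k n} {P : GBundle E G k}
    {Q : GBundle E G n} (f : GBundleMap m P Q) {r : SmoothMap j k} {s : Simplex j → P.Total}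
    {x : Simplex j} (hs : P.SmoothAlong r s x) :
    Q.SmoothAlong (m.comp r) (fun y => f.toFun (s y)) x := by
  obtain ⟨e', he', hx⟩ := Q.cover (m.toFun (r.toFun x))
  exact ⟨hs.1.mono fun y hy => by rw [f.proj_toFun, hy]; rfl, e', he', hx,
    f.smoothGermAt_triv_toFun hs he' hx⟩

/-- The `G`-valued function that represents `f` can be inverted, so bundle maps also reflect
smoothness. This is how sections are pulled back along morphisms of simplices. -/
theorem smoothAlong_of_comp {j k n : ℕ} {m : SmoothMap k n} {P : GBundle E G k}
    {Q : GBundle E G n} (f : GBundleMap m P Q) {r : SmoothMap j k} {s : Simplex j → P.Total}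
    {x : Simplex j} (hr : ∀ᶠ y in 𝓝 x, P.proj (s y) = r.toFun y)
    (hs : Q.SmoothAlong (m.comp r) (fun y => f.toFun (s y)) x) : P.SmoothAlong r s x := by
  obtain ⟨-, e', he', hx, h2⟩ := hs
  obtain ⟨e, he, hxe⟩ := P.cover (r.toFun x)
  refine ⟨hr, e, he, hxe, ?_⟩
  have hop : IsOpen {x | x ∈ e.baseSet ∧ m.toFun x ∈ e'.baseSet} :=
    e.open_baseSet.inter (e'.open_baseSet.preimage m.continuous)
  have h3 := (simplexSmoothOnInto_iff hop).1 (f.smooth e he e' he') _ ⟨hxe, hx⟩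
  refine ((h3.comp r).inv.mul h2).congr ?_
  filter_upwards [hr, GBundle.eventually_mem_baseSet r e hxe,
    GBundle.eventually_mem_baseSet (m.comp r) e' hx] with y a b c
  rw [f.triv_toFun he he' (s y) (by rwa [a]) (by rwa [a]), a, inv_mul_cancel_left]

end GBundleMap

variable [IsTopologicalAddGroup E] [ContinuousSMul ℝ E] [LocallyConvexSpace ℝ E]
  [T2Space E] [IsFrechetLieGroup E G]

namespace GBundle

variable {k n : ℕ} {P : GBundle E G n} {m : SmoothMap k n} {s s' : Simplex k → P.Total}
  {c : Simplex k → G} {x : Simplex k}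

/-- Smoothness does not depend on the trivialization: this is the smoothness of the identity bundle
map. -/
theorem SmoothAlong.smoothGermAt_triv (h : P.SmoothAlong m s x)
    {e : Bundle.Trivialization G P.proj} (he : e ∈ P.triv) (hx : m.toFun x ∈ e.baseSet) :
    SmoothGermAt E (fun y => (e (s y)).2) x :=
  (GBundleMap.id P).smoothGermAt_triv_toFun h he hx

theorem SmoothAlong.act (h : P.SmoothAlong m s x) (hc : SmoothGermAt E c x) :
    P.SmoothAlong m (fun y => P.act (s y) (c y)) x := by
  obtain ⟨h1, e, he, hx, h2⟩ := h
  refine ⟨h1.mono fun y hy => by rw [P.proj_act, hy], e, he, hx, (h2.mul hc).congr ?_⟩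
  filter_upwards [h1, eventually_mem_baseSet m e hx] with y a b
  rw [P.equivariant e he _ (by rwa [a])]

theorem SmoothAlong.smoothGermAt_of_act (h : P.SmoothAlong m s x)
    (h' : P.SmoothAlong m (fun y => P.act (s y) (c y)) x) : SmoothGermAt E c x := by
  obtain ⟨h1, e, he, hx, h2⟩ := h
  refine (h2.inv.mul (h'.smoothGermAt_triv he hx)).congr ?_
  filter_upwards [h1, eventually_mem_baseSet m e hx] with y a b
  rw [P.equivariant e he _ (by rwa [a]), inv_mul_cancel_left]

theorem SmoothAlong.comp_right {j : ℕ} {r : SmoothMap j k} {x : Simplex j}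
    (h : P.SmoothAlong m s (r.toFun x)) :
    P.SmoothAlong (m.comp r) (fun y => s (r.toFun y)) x := by
  obtain ⟨h1, e, he, hx, h2⟩ := h
  exact ⟨r.continuous.continuousAt.eventually h1, e, he, hx, h2.comp r⟩

end GBundle

namespace GBundleMap

/-- An equivariant map which is smooth on smooth local sections is a bundle map. -/
def ofSections {k n : ℕ} {m : SmoothMap k n} {P : GBundle E G k} {Q : GBundle E G n}
    (f : P.Total → Q.Total) (hproj : ∀ p, Q.proj (f p) = m.toFun (P.proj p))
    (hact : ∀ p g, f (P.act p g) = Q.act (f p) g)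
    (hf : ∀ x, ∃ s, P.SmoothAlong (SmoothMap.id k) s x ∧ Q.SmoothAlong m (fun y => f (s y)) x) :
    GBundleMap m P Q where
  toFun := f
  proj_toFun := hproj
  equivariant := hact
  smooth e he e' he' := by
    have hop : IsOpen {x | x ∈ e.baseSet ∧ m.toFun x ∈ e'.baseSet} :=
      e.open_baseSet.inter (e'.open_baseSet.preimage m.continuous)
    refine (simplexSmoothOnInto_iff hop).2 fun x hx => ?_
    obtain ⟨s, hs, hfs⟩ := hf x
    have h1 := hs.smoothGermAt_triv he hx.1
    have h2 := hfs.smoothGermAt_triv he' hx.2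
    refine (h2.mul h1.inv).congr ?_
    filter_upwards [hs.1, hop.mem_nhds hx] with y a b
    have a' : P.proj (s y) = y := a
    -- The unit section of `e` is the given smooth section divided by its own coordinate, so knowing
    -- `f` on one smooth section is enough.
    have h3 : P.act (s y) (e (s y)).2⁻¹ = e.toOpenPartialHomeomorph.symm (y, 1) := by
      have h4 : e (e.toOpenPartialHomeomorph.symm (y, 1)) = (y, 1) := e.apply_symm_apply' b.1
      refine P.eq_of_triv_eq (e := e) ?_ ?_ ?_
      · rw [P.proj_act, a']
        exact b.1
      · rw [P.proj_act, a']
        exact (e.proj_symm_apply' b.1).symm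
      · rw [P.equivariant e he _ (by rw [a']; exact b.1), h4, mul_inv_cancel]
    rw [← h3, hact, Q.equivariant e' he' _ (by rw [hproj, a']; exact b.2)]

/-- The composition of two bundle maps. -/
def comp {k n l : ℕ} {m : SmoothMap k n} {r : SmoothMap n l} {P : GBundle E G k}
    {Q : GBundle E G n} {R : GBundle E G l} (g : GBundleMap r Q R) (f : GBundleMap m P Q) :
    GBundleMap (r.comp m) P R :=
  ofSections (fun p => g.toFun (f.toFun p)) (fun p => by rw [g.proj_toFun, f.proj_toFun]; rfl)
    (fun p a => by rw [f.equivariant, g.equivariant]) fun x => by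
      obtain ⟨e, he, hx⟩ := P.cover x
      exact ⟨_, GBundle.smoothAlong_symm he hx,
        g.smoothAlong (f.smoothAlong (GBundle.smoothAlong_symm he hx))⟩

end GBundleMap

end Sections

/-! ### The classifying map of a simplicial bundle -/

namespace SmoothSSet

/-- The smooth map `Δ^n_• → X` determined by an `n`-simplex of `X`. -/
def charMap {X : SmoothSSet.{w}} {n : ℕ} (S : X.obj n) : Hom (std n) X where
  app s := X.map s S
  naturality s t := X.map_comp t s S

theorem charMap_map {X : SmoothSSet.{w}} {k n : ℕ} (s : SmoothMap k n) (S : X.obj n) :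
    charMap (X.map s S) = (charMap S).comp (stdMap s) := by
  ext j t
  exact (X.map_comp s t S).symm

theorem comp_charMap {X : SmoothSSet.{w}} {X' : SmoothSSet.{w'}} (h : Hom X X') {n : ℕ}
    (S : X.obj n) : h.comp (charMap S) = charMap (h.app S) := by
  ext j t
  exact h.naturality t S

end SmoothSSet

open SmoothSSet (Hom)

section Classifying

variable {E : Type v} [AddCommGroup E] [Module ℝ E] [TopologicalSpace E]
  {G : Type u} [TopologicalSpace G] [ChartedSpace E G] [Group G]

/-- The types of the bundle maps depend on the bundles, so the maps can only be compared
heterogeneously until the bundles have been identified. -/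
theorem SimplicialGBundle.ext_of_heq {X : SmoothSSet.{w}} {P Q : SimplicialGBundle E G X}
    (hobj : ∀ {n : ℕ} (S : X.obj n), P.obj S = Q.obj S)
    (hmap : ∀ {k n : ℕ} (S : X.obj k) (T : X.obj n) (m : SmoothMap k n) (h : X.map m T = S),
      HEq (P.map S T m h) (Q.map S T m h)) : P = Q := by
  obtain ⟨obj, map, _, _⟩ := P
  obtain ⟨obj', map', _, _⟩ := Q
  have h1 : @obj = @obj' := by
    funext n S
    exact hobj S
  subst h1
  have h2 : @map = @map' := by
    funext k n S T m h
    exact eq_of_heq (hmap S T m h)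
  subst h2
  rfl

/-- The map `X → BG` determined by a simplicial `G`-bundle over `X`. -/
def classifyingMap {X : SmoothSSet.{w}} (P : SimplicialGBundle E G X) : Hom X (BG E G) where
  app S := P.pullback (SmoothSSet.charMap S)
  naturality s S := by
    rw [SmoothSSet.charMap_map]
    rfl

theorem classifyingMap_pullback {X : SmoothSSet.{w}} {X' : SmoothSSet.{w'}} (h : Hom X X')
    (P : SimplicialGBundle E G X') :
    classifyingMap (P.pullback h) = (classifyingMap P).comp h := by
  ext n S
  change P.pullback (h.comp (SmoothSSet.charMap S)) = P.pullback (SmoothSSet.charMap (h.app S))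
  rw [SmoothSSet.comp_charMap]

theorem SimplicialGBundle.map_heq {X : SmoothSSet.{w}} (P : SimplicialGBundle E G X) {k n : ℕ}
    {S S' : X.obj k} {T T' : X.obj n} (m : SmoothMap k n) (hS : S = S') (hT : T = T')
    (h : X.map m T = S) (h' : X.map m T' = S') : HEq (P.map S T m h) (P.map S' T' m h') := by
  subst hS hT
  rfl

theorem EGMap_heq {k n : ℕ} (S : (BG E G).obj k) (T : (BG E G).obj n) (m : SmoothMap k n)
    (h : (BG E G).map m T = S) :
    HEq (EGMap E G S T m h) (SimplicialGBundle.map T m (SmoothMap.id n) m rfl) := by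
  subst h
  rfl

/-- The value at `S` is `P` at `X(id)(S)`, which is `S` by a functor law. That law is a
propositional equality, hence the detour through `HEq`. -/
theorem EG_pullback_classifyingMap {X : SmoothSSet.{w}} (P : SimplicialGBundle E G X) :
    (EG E G).pullback (classifyingMap P) = P := by
  refine SimplicialGBundle.ext_of_heq (fun S => congrArg P.obj (X.map_id S)) ?_
  intro k n S T m h
  refine (EGMap_heq _ _ _ _).trans ?_
  exact P.map_heq m h (X.map_id T) _ _

/-- By naturality of `f`, the value of the bundle `f(S)` at `t` is the value of `f(t^*S)` at the
identity. Thus `f` can be recovered from `f^*EG`. -/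
theorem classifyingMap_EG_pullback {X : SmoothSSet.{w}} (f : Hom X (BG E G)) :
    classifyingMap ((EG E G).pullback f) = f := by
  ext n S
  refine SimplicialGBundle.ext_of_heq (fun {k} s => ?_) ?_
  · exact congrArg (fun T : (BG E G).obj k => SimplicialGBundle.obj T (SmoothMap.id k))
      (f.naturality s S)
  · intro j k s t m h
    refine (EGMap_heq _ _ _ _).trans ?_
    subst h
    -- Naturality of `f` can only be substituted once its left-hand side is a variable.
    have key : ∀ (A : (BG E G).obj k) (_ : A = (BG E G).map t (f.app S)),
        HEq (SimplicialGBundle.map A m (SmoothMap.id k) m rfl)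
          (SimplicialGBundle.map (f.app S) (t.comp m) t m rfl) := by
      rintro _ rfl
      rfl
    exact key _ (f.naturality t S)

/-! ### Isomorphic bundles have homotopic classifying maps -/

variable [IsTopologicalAddGroup E] [ContinuousSMul ℝ E] [LocallyConvexSpace ℝ E]
  [T2Space E] [IsFrechetLieGroup E G]

namespace SimplicialGBundle

variable {X : SmoothSSet.{w}}

theorem isomorphic_refl (P : SimplicialGBundle E G X) : P.Isomorphic P :=
  ⟨{ hom := fun S => GBundleMap.id (P.obj S)
     inv := fun S => GBundleMap.id (P.obj S)
     hom_natural := fun _ _ _ _ _ => rfl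
     inv_natural := fun _ _ _ _ _ => rfl
     inv_hom := fun _ _ => rfl
     hom_inv := fun _ _ => rfl }⟩

/-- The inverse of an isomorphism of simplicial bundles. -/
def Iso.symm {P Q : SimplicialGBundle E G X} (i : Iso P Q) : Iso Q P where
  hom := i.inv
  inv := i.hom
  hom_natural := i.inv_natural
  inv_natural := i.hom_natural
  inv_hom := i.hom_inv
  hom_inv := i.inv_hom

/-- The composition of two isomorphisms of simplicial bundles. -/
def Iso.trans {P Q R : SimplicialGBundle E G X} (i : Iso P Q) (j : Iso Q R) : Iso P R where
  hom S := (j.hom S).comp (i.hom S)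
  inv S := (i.inv S).comp (j.inv S)
  hom_natural S T m h p :=
    (congrArg (j.hom T).toFun (i.hom_natural S T m h p)).trans (j.hom_natural S T m h _)
  inv_natural S T m h p :=
    (congrArg (i.inv T).toFun (j.inv_natural S T m h p)).trans (i.inv_natural S T m h _)
  inv_hom S p := (congrArg (i.inv S).toFun (j.inv_hom S _)).trans (i.inv_hom S p)
  hom_inv S p := (congrArg (j.hom S).toFun (i.hom_inv S _)).trans (j.hom_inv S p)

variable (P Q : SimplicialGBundle E G X)

/-- The bundle `P` or `Q`, according to a Boolean. -/
def choice : Bool → SimplicialGBundle E G X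
  | true => P
  | false => Q

variable {P Q}

/-- The bundle maps between the members of a pair of isomorphic bundles. -/
def transition (i : Iso P Q) : ∀ (a b : Bool) {n : ℕ} (S : X.obj n),
    GBundleMap (SmoothMap.id n) ((choice P Q a).obj S) ((choice P Q b).obj S)
  | true, true, _, S => GBundleMap.id (P.obj S)
  | true, false, _, S => i.hom S
  | false, true, _, S => i.inv S
  | false, false, _, S => GBundleMap.id (Q.obj S)

theorem transition_self (i : Iso P Q) (a : Bool) {n : ℕ} (S : X.obj n)
    (p : ((choice P Q a).obj S).Total) : (transition i a a S).toFun p = p := by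
  cases a <;> rfl

theorem transition_trans (i : Iso P Q) (a b c : Bool) {n : ℕ} (S : X.obj n)
    (p : ((choice P Q a).obj S).Total) :
    (transition i b c S).toFun ((transition i a b S).toFun p) = (transition i a c S).toFun p := by
  cases a <;> cases b <;> cases c <;>
    first | rfl | exact i.inv_hom S p | exact i.hom_inv S p

theorem transition_natural (i : Iso P Q) (a b : Bool) {k n : ℕ} (S : X.obj k) (T : X.obj n)
    (m : SmoothMap k n) (h : X.map m T = S) (p : ((choice P Q a).obj S).Total) :
    (transition i a b T).toFun (((choice P Q a).map S T m h).toFun p) =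
      ((choice P Q b).map S T m h).toFun ((transition i a b S).toFun p) := by
  cases a <;> cases b <;>
    first | rfl | exact i.hom_natural S T m h p | exact i.inv_natural S T m h p

/-- The bundle map that changes from one member of a pair of isomorphic bundles to another. -/
def mixedMap (i : Iso P Q) (a b : Bool) {k n : ℕ} (S : X.obj k) (T : X.obj n)
    (m : SmoothMap k n) (h : X.map m T = S) :
    GBundleMap m ((choice P Q a).obj S) ((choice P Q b).obj T) :=
  ((choice P Q b).map S T m h).comp (transition i a b S)

theorem mixedMap_toFun (i : Iso P Q) (a b : Bool) {k n : ℕ} (S : X.obj k) (T : X.obj n)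
    (m : SmoothMap k n) (h : X.map m T = S) (p : ((choice P Q a).obj S).Total) :
    (mixedMap i a b S T m h).toFun p =
      ((choice P Q b).map S T m h).toFun ((transition i a b S).toFun p) := rfl

theorem mixedMap_heq (i : Iso P Q) {a b c : Bool} (ha : a = c) (hb : b = c) {k n : ℕ}
    (S : X.obj k) (T : X.obj n) (m : SmoothMap k n) (h : X.map m T = S) :
    HEq (mixedMap i a b S T m h) ((choice P Q c).map S T m h) := by
  subst ha hb
  refine heq_of_eq (GBundleMap.ext (funext fun p => ?_))
  rw [mixedMap_toFun, transition_self]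

/-- Given isomorphic bundles `P` and `Q` over `X`, the bundle over `X × Y` whose value at `(S, T)`
is `P(S)` or `Q(S)`, according to an arbitrary Boolean function of `T`. -/
def mixed (i : Iso P Q) (Y : SmoothSSet.{w'}) (b : ∀ {n : ℕ}, Y.obj n → Bool) :
    SimplicialGBundle E G (X.prod Y) where
  obj S := (choice P Q (b S.2)).obj S.1
  map S T m h := mixedMap i (b S.2) (b T.2) S.1 T.1 m (congrArg Prod.fst h)
  map_id {n} S h p :=
    (congrArg ((choice P Q (b S.2)).map S.1 S.1 (SmoothMap.id n) (congrArg Prod.fst h)).toFun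
      (transition_self i (b S.2) S.1 p)).trans ((choice P Q (b S.2)).map_id S.1 _ p)
  map_comp R S T m s hm hs h p := by
    refine ((choice P Q (b T.2)).map_comp R.1 S.1 T.1 m s (congrArg Prod.fst hm)
      (congrArg Prod.fst hs) (congrArg Prod.fst h) _).trans ?_
    refine congrArg ((choice P Q (b T.2)).map S.1 T.1 s (congrArg Prod.fst hs)).toFun ?_
    -- Naturality moves the second change of bundle before the map of `m`, where it merges with the
    -- first.
    refine Eq.trans ?_ (transition_natural i (b S.2) (b T.2) R.1 S.1 m (congrArg Prod.fst hm) _).symm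
    exact congrArg ((choice P Q (b T.2)).map R.1 S.1 m (congrArg Prod.fst hm)).toFun
      (transition_trans i (b R.2) (b S.2) (b T.2) R.1 p).symm

/-- Where the Boolean is constant, all inserted transitions are identities, so the restriction
equals the chosen bundle and is not merely isomorphic to it. -/
theorem mixed_pullback (i : Iso P Q) {Y : SmoothSSet.{w'}} (b : ∀ {n : ℕ}, Y.obj n → Bool)
    (c : Bool) (f : Hom X (X.prod Y)) (hf : ∀ {n : ℕ} (S : X.obj n), (f.app S).1 = S)
    (hb : ∀ {n : ℕ} (S : X.obj n), b (f.app S).2 = c) :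
    (mixed i Y b).pullback f = choice P Q c := by
  refine ext_of_heq (fun {n} S => ?_) fun {k n} S T m h => ?_
  · change (choice P Q (b (f.app S).2)).obj (f.app S).1 = _
    rw [hb, hf]
  · refine (mixedMap_heq i (hb S) (hb T) _ _ m _).trans ?_
    exact (choice P Q c).map_heq m (hf S) (hf T) _ _

end SimplicialGBundle

/-- The inclusion of `X` in `X × Δ^1_•` at a point of `Δ^1`. -/
def SmoothSSet.inclusion (X : SmoothSSet.{w}) {d : ℕ} (p : Simplex d) :
    Hom X (X.prod (SmoothSSet.std d)) where
  app S := (S, SmoothMap.const _ p)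
  naturality _ _ := rfl

theorem const_vertexOne_ne (n : ℕ) :
    SmoothMap.const n vertexOne ≠ SmoothMap.const n vertexZero := by
  intro h
  have h1 := congrArg (fun m : SmoothMap n 1 => (m.toFun ⟨fun _ => 0, by simp [simplexSet]⟩).1 0) h
  simp [SmoothMap.const, vertexZero, vertexOne] at h1

open Classical in
theorem smoothlyHomotopic_of_isomorphic {X : SmoothSSet.{w}} {f g : Hom X (BG E G)}
    (h : ((EG E G).pullback f).Isomorphic ((EG E G).pullback g)) : SmoothlyHomotopic f g := by
  obtain ⟨i⟩ := h
  -- Every simplex of `Δ^1_•` other than a constant one at vertex 0 takes the second bundle; no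
  -- compatibility is required of this choice.
  let b : ∀ {n : ℕ}, (SmoothSSet.std 1).obj n → Bool :=
    fun {n} c => decide (c = SmoothMap.const n vertexZero)
  let Q := SimplicialGBundle.mixed i (SmoothSSet.std 1) b
  have h0 : (classifyingMap Q).comp (X.inclusion vertexZero) = f := by
    rw [← classifyingMap_pullback, SimplicialGBundle.mixed_pullback i b true _ (fun _ => rfl)
      (fun S => decide_eq_true rfl)]
    exact classifyingMap_EG_pullback f
  have h1 : (classifyingMap Q).comp (X.inclusion vertexOne) = g := by
    rw [← classifyingMap_pullback, SimplicialGBundle.mixed_pullback i b false _ (fun _ => rfl)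
      (fun S => decide_eq_false (const_vertexOne_ne _))]
    exact classifyingMap_EG_pullback g
  refine ⟨classifyingMap Q, fun n S => ⟨?_, ?_⟩⟩
  · rw [← h0]
    rfl
  · rw [← h1]
    rfl

end Classifying

/-! ### Smooth families of frames of a simplicial bundle -/

/-- The point of `X` that the simplex `S` takes as its value at `x`. -/
def SmoothSSet.point {X : SmoothSSet.{w}} {n : ℕ} (S : X.obj n) (x : Simplex n) : X.obj 0 :=
  X.map (SmoothMap.const 0 x) S

theorem SmoothSSet.point_map {X : SmoothSSet.{w}} {k n : ℕ} {S : X.obj k} {T : X.obj n}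
    {m : SmoothMap k n} (h : X.map m T = S) (x : Simplex k) :
    point S x = point T (m.toFun x) := by
  subst h
  exact (X.map_comp m (SmoothMap.const 0 x) T).symm

section Frames

variable {E : Type v} [AddCommGroup E] [Module ℝ E] [TopologicalSpace E]
  {G : Type u} [TopologicalSpace G] [ChartedSpace E G] [Group G]

namespace SimplicialGBundle

variable {X : SmoothSSet.{w}} (P : SimplicialGBundle E G X)

/-- An arbitrary choice of a frame over each point. -/
noncomputable def frame (z : X.obj 0) : (P.obj z).Total :=
  Classical.choose ((P.obj z).exists_proj_eq ⟨fun _ => 0, by simp [simplexSet]⟩)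

/-- The section, usually not continuous, of the bundle over a simplex that is given by the chosen
frames over the points. -/
noncomputable def frameAlong {n : ℕ} (S : X.obj n) (x : Simplex n) : (P.obj S).Total :=
  (P.map (SmoothSSet.point S x) S (SmoothMap.const 0 x) rfl).toFun (P.frame _)

theorem proj_frameAlong {n : ℕ} (S : X.obj n) (x : Simplex n) :
    (P.obj S).proj (P.frameAlong S x) = x :=
  (P.map _ S (SmoothMap.const 0 x) rfl).proj_toFun _

theorem frameAlong_eq {n : ℕ} (S : X.obj n) (x : Simplex n) {z : X.obj 0}
    (h : X.map (SmoothMap.const 0 x) S = z) :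
    (P.map z S (SmoothMap.const 0 x) h).toFun (P.frame z) = P.frameAlong S x := by
  subst h
  rfl

/-- Both sides are images of the frame over the same 0-simplex, so functoriality identifies them.
The chosen frames, however discontinuous, are preserved by all morphisms. -/
theorem map_frameAlong {k n : ℕ} (S : X.obj k) (T : X.obj n) (m : SmoothMap k n)
    (h : X.map m T = S) (x : Simplex k) :
    (P.map S T m h).toFun (P.frameAlong S x) = P.frameAlong T (m.toFun x) := by
  rw [← P.frameAlong_eq T (m.toFun x) (SmoothSSet.point_map h x).symm]
  exact (P.map_comp _ S T (SmoothMap.const 0 x) m rfl h _ _).symm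

/-- The coordinate of a point of the bundle over a simplex with respect to the chosen frames. -/
noncomputable def coord {n : ℕ} (S : X.obj n) (p : (P.obj S).Total) : G :=
  Classical.choose ((P.obj S).exists_act_eq (P.proj_frameAlong S ((P.obj S).proj p)))

theorem act_coord {n : ℕ} (S : X.obj n) (p : (P.obj S).Total) :
    (P.obj S).act (P.frameAlong S ((P.obj S).proj p)) (P.coord S p) = p :=
  Classical.choose_spec ((P.obj S).exists_act_eq (P.proj_frameAlong S ((P.obj S).proj p)))

theorem coord_eq {n : ℕ} (S : X.obj n) {p : (P.obj S).Total} {x : Simplex n} {g : G}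
    (h : (P.obj S).act (P.frameAlong S x) g = p) : P.coord S p = g := by
  have hx : (P.obj S).proj p = x := by rw [← h, (P.obj S).proj_act, proj_frameAlong]
  refine (P.obj S).act_injective (P.frameAlong S x) ?_
  rw [h, ← hx, act_coord]

theorem coord_act {n : ℕ} (S : X.obj n) (p : (P.obj S).Total) (g : G) :
    P.coord S ((P.obj S).act p g) = P.coord S p * g :=
  P.coord_eq S (x := (P.obj S).proj p) (by rw [(P.obj S).act_mul, act_coord])

theorem coord_map {k n : ℕ} (S : X.obj k) (T : X.obj n) (m : SmoothMap k n)
    (h : X.map m T = S) (p : (P.obj S).Total) :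
    P.coord T ((P.map S T m h).toFun p) = P.coord S p :=
  P.coord_eq T (x := m.toFun ((P.obj S).proj p)) (by
    rw [← P.map_frameAlong S T m h, ← (P.map S T m h).equivariant, act_coord])

/-- The `G`-valued function `c` on a simplex describes, with respect to the chosen frames, a section
of the bundle over the simplex that is smooth at `x`. -/
def SmoothFrameAt {n : ℕ} (S : X.obj n) (c : Simplex n → G) (x : Simplex n) : Prop :=
  (P.obj S).SmoothAlong (SmoothMap.id n) (fun y => (P.obj S).act (P.frameAlong S y) (c y)) x

variable {P}

theorem SmoothFrameAt.congr {n : ℕ} {S : X.obj n} {c c' : Simplex n → G} {x : Simplex n}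
    (h : P.SmoothFrameAt S c x) (hc : ∀ᶠ y in 𝓝 x, c y = c' y) : P.SmoothFrameAt S c' x :=
  GBundle.SmoothAlong.congr h (Filter.Eventually.of_forall fun _ => rfl)
    (hc.mono fun y hy => by rw [hy])

theorem SmoothFrameAt.eventually {n : ℕ} {S : X.obj n} {c : Simplex n → G} {x : Simplex n}
    (h : P.SmoothFrameAt S c x) : ∀ᶠ y in 𝓝 x, P.SmoothFrameAt S c y :=
  GBundle.SmoothAlong.eventually h

variable [IsTopologicalAddGroup E] [ContinuousSMul ℝ E] [LocallyConvexSpace ℝ E]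
  [T2Space E] [IsFrechetLieGroup E G]

theorem SmoothFrameAt.mul {n : ℕ} {S : X.obj n} {c h : Simplex n → G} {x : Simplex n}
    (hc : P.SmoothFrameAt S c x) (hh : SmoothGermAt E h x) :
    P.SmoothFrameAt S (fun y => c y * h y) x :=
  (GBundle.SmoothAlong.act hc hh).congr (Filter.Eventually.of_forall fun _ => rfl)
    (Filter.Eventually.of_forall fun _ => ((P.obj S).act_mul _ _ _).symm)

/-- The irregularity of the chosen frames cancels in a quotient of two smooth sections, which leaves
an honest smooth germ in `G`. -/
theorem SmoothFrameAt.div {n : ℕ} {S : X.obj n} {c c' : Simplex n → G} {x : Simplex n}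
    (hc : P.SmoothFrameAt S c x) (hc' : P.SmoothFrameAt S c' x) :
    SmoothGermAt E (fun y => (c y)⁻¹ * c' y) x := by
  refine GBundle.SmoothAlong.smoothGermAt_of_act hc
    (GBundle.SmoothAlong.congr hc' (Filter.Eventually.of_forall fun _ => rfl)
      (Filter.Eventually.of_forall fun y => ?_))
  rw [← (P.obj S).act_mul, mul_inv_cancel_left]

variable (P) in
theorem exists_smoothFrameAt {n : ℕ} (S : X.obj n) (x : Simplex n) :
    ∃ c, P.SmoothFrameAt S c x := by
  obtain ⟨e, he, hx⟩ := (P.obj S).cover x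
  have h := GBundle.smoothAlong_symm he hx
  refine ⟨fun y => P.coord S (e.toOpenPartialHomeomorph.symm (y, 1)),
    h.congr (Filter.Eventually.of_forall fun _ => rfl) ?_⟩
  filter_upwards [h.1] with y hy
  have hy' : (P.obj S).proj (e.toOpenPartialHomeomorph.symm (y, 1)) = y := hy
  conv_lhs => rw [← P.act_coord S (e.toOpenPartialHomeomorph.symm (y, 1)), hy']

/-- The bundle map over `m` carries the section `c ∘ m` to the section `c` taken along `m`, and
bundle maps reflect smoothness. -/
theorem SmoothFrameAt.comp {k n : ℕ} {S : X.obj k} {T : X.obj n} {m : SmoothMap k n}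
    (hm : X.map m T = S) {c : Simplex n → G} {x : Simplex k}
    (h : P.SmoothFrameAt T c (m.toFun x)) :
    P.SmoothFrameAt S (fun y => c (m.toFun y)) x := by
  refine (P.map S T m hm).smoothAlong_of_comp (Filter.Eventually.of_forall fun y => ?_) ?_
  · rw [(P.obj S).proj_act, P.proj_frameAlong]
    rfl
  · refine (GBundle.SmoothAlong.comp_right h).congr (Filter.Eventually.of_forall fun _ => rfl)
      (Filter.Eventually.of_forall fun y => ?_)
    rw [(P.map S T m hm).equivariant, P.map_frameAlong]

/-- Smoothness at `x` may be checked after composition with a map which is the identity near `x`. -/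
theorem SmoothFrameAt.of_comp {n : ℕ} {S T : X.obj n} {m : SmoothMap n n}
    (hm : X.map m T = S) {c : Simplex n → G} {x : Simplex n}
    (hx : ∀ᶠ y in 𝓝 x, m.toFun y = y)
    (h : P.SmoothFrameAt S (fun y => c (m.toFun y)) x) : P.SmoothFrameAt T c x := by
  refine ((P.map S T m hm).smoothAlong h).congr hx ?_
  filter_upwards [hx] with y hy
  rw [(P.map S T m hm).equivariant, P.map_frameAlong, hy]

/-! ### Isomorphisms given by `G`-valued functions of the points -/

section Gauge

variable {X₀ : SmoothSSet.{w'}}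

variable (P) in
/-- The bundle map given by a `G`-valued function of the points, with respect to the chosen
frames. -/
noncomputable def gaugeMap (i j : Hom X₀ X) (θ : X₀.obj 0 → G)
    (hθ : ∀ {n : ℕ} (S : X₀.obj n) (c : Simplex n → G) (x : Simplex n),
      P.SmoothFrameAt (i.app S) c x →
      P.SmoothFrameAt (j.app S) (fun y => θ (SmoothSSet.point S y) * c y) x)
    {n : ℕ} (S : X₀.obj n) :
    GBundleMap (SmoothMap.id n) (P.obj (i.app S)) (P.obj (j.app S)) :=
  GBundleMap.ofSections
    (fun p => (P.obj (j.app S)).act (P.frameAlong (j.app S) ((P.obj (i.app S)).proj p))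
      (θ (SmoothSSet.point S ((P.obj (i.app S)).proj p)) * P.coord (i.app S) p))
    (fun p => by rw [(P.obj (j.app S)).proj_act, proj_frameAlong]; rfl)
    (fun p g => by
      rw [coord_act, (P.obj (i.app S)).proj_act, ← mul_assoc, (P.obj (j.app S)).act_mul])
    (fun x => by
      obtain ⟨c, hc⟩ := P.exists_smoothFrameAt (i.app S) x
      refine ⟨_, hc, GBundle.SmoothAlong.congr (hθ S c x hc) (Filter.Eventually.of_forall fun _ => rfl)
        (Filter.Eventually.of_forall fun y => ?_)⟩
      rw [P.coord_eq (i.app S) rfl, (P.obj (i.app S)).proj_act, proj_frameAlong])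

theorem gaugeMap_toFun (i j : Hom X₀ X) (θ : X₀.obj 0 → G)
    (hθ : ∀ {n : ℕ} (S : X₀.obj n) (c : Simplex n → G) (x : Simplex n),
      P.SmoothFrameAt (i.app S) c x →
      P.SmoothFrameAt (j.app S) (fun y => θ (SmoothSSet.point S y) * c y) x)
    {n : ℕ} (S : X₀.obj n) (p : (P.obj (i.app S)).Total) : (P.gaugeMap i j θ hθ S).toFun p =
      (P.obj (j.app S)).act (P.frameAlong (j.app S) ((P.obj (i.app S)).proj p))
        (θ (SmoothSSet.point S ((P.obj (i.app S)).proj p)) * P.coord (i.app S) p) := rfl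

theorem gaugeMap_natural (i j : Hom X₀ X) (θ : X₀.obj 0 → G)
    (hθ : ∀ {n : ℕ} (S : X₀.obj n) (c : Simplex n → G) (x : Simplex n),
      P.SmoothFrameAt (i.app S) c x →
      P.SmoothFrameAt (j.app S) (fun y => θ (SmoothSSet.point S y) * c y) x)
    {k n : ℕ} (S : X₀.obj k) (T : X₀.obj n) (m : SmoothMap k n) (h : X₀.map m T = S)
    (hi : X.map m (i.app T) = i.app S) (hj : X.map m (j.app T) = j.app S)
    (p : (P.obj (i.app S)).Total) :
    (P.gaugeMap i j θ hθ T).toFun ((P.map (i.app S) (i.app T) m hi).toFun p) =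
      (P.map (j.app S) (j.app T) m hj).toFun ((P.gaugeMap i j θ hθ S).toFun p) := by
  rw [gaugeMap_toFun, gaugeMap_toFun, coord_map, (P.map _ _ m hi).proj_toFun,
    (P.map _ _ m hj).equivariant, map_frameAlong, SmoothSSet.point_map h]

theorem gaugeMap_gaugeMap (i j : Hom X₀ X) (θ θ' : X₀.obj 0 → G)
    (hθ : ∀ {n : ℕ} (S : X₀.obj n) (c : Simplex n → G) (x : Simplex n),
      P.SmoothFrameAt (i.app S) c x →
      P.SmoothFrameAt (j.app S) (fun y => θ (SmoothSSet.point S y) * c y) x)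
    (hθ' : ∀ {n : ℕ} (S : X₀.obj n) (c : Simplex n → G) (x : Simplex n),
      P.SmoothFrameAt (j.app S) c x →
      P.SmoothFrameAt (i.app S) (fun y => θ' (SmoothSSet.point S y) * c y) x)
    (h : ∀ z, θ' z * θ z = 1) {n : ℕ} (S : X₀.obj n) (p : (P.obj (i.app S)).Total) :
    (P.gaugeMap j i θ' hθ' S).toFun ((P.gaugeMap i j θ hθ S).toFun p) = p := by
  rw [gaugeMap_toFun, gaugeMap_toFun, P.coord_eq (j.app S) rfl, (P.obj (j.app S)).proj_act,
    proj_frameAlong, ← mul_assoc, h, one_mul, act_coord]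

/-- Two pull-backs of a simplicial bundle are isomorphic if a `G`-valued function of the points
takes smooth sections to smooth sections. -/
theorem pullback_isomorphic (i j : Hom X₀ X) (θ : X₀.obj 0 → G)
    (hθ : ∀ {n : ℕ} (S : X₀.obj n) (c : Simplex n → G) (x : Simplex n),
      P.SmoothFrameAt (i.app S) c x →
      P.SmoothFrameAt (j.app S) (fun y => θ (SmoothSSet.point S y) * c y) x) :
    (P.pullback i).Isomorphic (P.pullback j) := by
  have hθ' : ∀ {n : ℕ} (S : X₀.obj n) (c : Simplex n → G) (x : Simplex n),
      P.SmoothFrameAt (j.app S) c x →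
      P.SmoothFrameAt (i.app S) (fun y => (θ (SmoothSSet.point S y))⁻¹ * c y) x := by
    intro n S c x hc
    -- An auxiliary smooth section `c'` gives `θ⁻¹ c = c' (θ c')⁻¹ c`, where `(θ c')⁻¹ c` is a
    -- quotient of smooth sections.
    obtain ⟨c', hc'⟩ := P.exists_smoothFrameAt (i.app S) x
    refine (hc'.mul ((hθ S c' x hc').div hc)).congr (Filter.Eventually.of_forall fun y => ?_)
    group
  exact ⟨{
    hom := P.gaugeMap i j θ hθ
    inv := P.gaugeMap j i (fun z => (θ z)⁻¹) hθ'
    hom_natural := fun S T m h p => gaugeMap_natural i j θ hθ S T m h _ _ p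
    inv_natural := fun S T m h p => gaugeMap_natural j i _ hθ' S T m h _ _ p
    inv_hom := gaugeMap_gaugeMap i j _ _ hθ hθ' fun z => inv_mul_cancel _
    hom_inv := gaugeMap_gaugeMap j i _ _ hθ' hθ fun z => mul_inv_cancel _ }⟩

end Gauge

end SimplicialGBundle

end Frames

/-! ### Smooth maps out of simplices -/

/-- The displacement from `x` is scaled by a bump function. Images stay on the segment to `x`, so
convex sets containing `x`, such as simplices, are preserved. -/
theorem exists_contDiff_localizing {V : Type*} [NormedAddCommGroup V] [NormedSpace ℝ V]
    [FiniteDimensional ℝ V] (x : V) {r : ℝ} (hr : 0 < r) : ∃ ρ : V → V, ContDiff ℝ ∞ ρ ∧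
      (∀ᶠ y in 𝓝 x, ρ y = y) ∧ (∀ y, ρ y ∈ Metric.ball x r) ∧ ∀ y, ρ y ∈ segment ℝ x y := by
  let f : ContDiffBump x := ⟨r / 2, r, half_pos hr, half_lt_self hr⟩
  refine ⟨fun y => x + f y • (y - x), contDiff_const.add (f.contDiff.smul (contDiff_id.sub
    contDiff_const)), ?_, fun y => ?_, fun y => ?_⟩
  · filter_upwards [f.eventuallyEq_one] with y hy
    rw [hy]
    simp
  · by_cases hy : f y = 0
    · simp [hy, hr]
    · have h1 : y ∈ Metric.ball x r := by
        rw [← show f.rOut = r from rfl, ← f.support_eq]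
        exact hy
      rw [mem_ball_iff_norm] at h1 ⊢
      rw [add_sub_cancel_left, norm_smul, Real.norm_of_nonneg f.nonneg]
      exact (mul_le_of_le_one_left (norm_nonneg _) f.le_one).trans_lt h1
  · rw [segment_eq_image']
    exact ⟨f y, ⟨f.nonneg, f.le_one⟩, rfl⟩

theorem convex_simplexSet (n : ℕ) : Convex ℝ (simplexSet n) := by
  intro x hx z hz a b ha hb hab
  refine ⟨fun i => add_nonneg (mul_nonneg ha (hx.1 i)) (mul_nonneg hb (hz.1 i)), ?_⟩
  simp only [Pi.add_apply, Pi.smul_apply, smul_eq_mul, Finset.sum_add_distrib, ← Finset.mul_sum]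
  nlinarith [hx.2, hz.2]

/-- There are smooth maps from the simplex to any neighbourhood of a point that are the identity
near the point. -/
theorem exists_smoothMap_localizing {n : ℕ} {x : Simplex n} {U : Set (Simplex n)} (hU : U ∈ 𝓝 x) :
    ∃ ρ : SmoothMap n n, (∀ᶠ y in 𝓝 x, ρ.toFun y = y) ∧ ∀ y, ρ.toFun y ∈ U := by
  obtain ⟨W, hW, hxW, hWU⟩ := exists_open_of_mem_nhds_simplex hU
  obtain ⟨r, hr, hrW⟩ := Metric.isOpen_iff.1 hW _ hxW
  obtain ⟨ρ, hρ, hρx, hρr, hρs⟩ := exists_contDiff_localizing x.1 hr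
  refine ⟨⟨fun y => ⟨ρ y.1, (convex_simplexSet n).segment_subset x.2 y.2 (hρs y.1)⟩, fun y =>
    ⟨Set.univ, ρ, isOpen_univ, trivial, hρ.contMDiff.contMDiffOn, fun _ _ => rfl⟩⟩, ?_,
    fun y => hWU _ (hrW (hρr y.1))⟩
  exact (continuous_subtype_val.continuousAt.eventually hρx).mono fun y hy => Subtype.ext hy

/-! ### Smooth simplices in manifolds -/

section SimplexSmooth

variable {H : Type*} [NormedAddCommGroup H] [NormedSpace ℝ H] {B : Type*}
  [TopologicalSpace B] {I : ModelWithCorners ℝ H B} {M : Type*} [TopologicalSpace M]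
  [ChartedSpace B M] {H' : Type*} [NormedAddCommGroup H'] [NormedSpace ℝ H'] {B' : Type*}
  [TopologicalSpace B'] {I' : ModelWithCorners ℝ H' B'} {M' : Type*} [TopologicalSpace M']
  [ChartedSpace B' M'] {k : ℕ}

theorem SimplexSmooth.contMDiffOn_comp {f : Simplex k → M} (hf : SimplexSmooth I f) {g : M → M'}
    {O : Set M} (hO : IsOpen O) (hg : ContMDiffOn I I' ∞ g O) (hfO : ∀ x, f x ∈ O) :
    SimplexSmooth I' (fun x => g (f x)) := by
  intro x
  obtain ⟨V, F, hV, hxV, hF, hFf⟩ := hf x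
  refine ⟨V ∩ F ⁻¹' O, fun y => g (F y), hF.continuousOn.isOpen_inter_preimage hV hO,
    ⟨hxV, ?_⟩, hg.comp (hF.mono Set.inter_subset_left) Set.inter_subset_right, ?_⟩
  · rw [Set.mem_preimage, hFf x hxV]
    exact hfO x
  · intro y hy
    exact congrArg g (hFf y hy.1)

theorem SimplexSmooth.contMDiff_comp {f : Simplex k → M} (hf : SimplexSmooth I f) {g : M → M'}
    (hg : ContMDiff I I' ∞ g) : SimplexSmooth I' (fun x => g (f x)) :=
  hf.contMDiffOn_comp isOpen_univ hg.contMDiffOn fun _ => trivial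

theorem SimplexSmooth.prodMk {f : Simplex k → M} (hf : SimplexSmooth I f) {g : Simplex k → M'}
    (hg : SimplexSmooth I' g) : SimplexSmooth (I.prod I') (fun x => (f x, g x)) := by
  intro x
  obtain ⟨V, F, hV, hxV, hF, hFf⟩ := hf x
  obtain ⟨V', F', hV', hxV', hF', hFf'⟩ := hg x
  exact ⟨V ∩ V', fun y => (F y, F' y), hV.inter hV', ⟨hxV, hxV'⟩,
    (hF.mono Set.inter_subset_left).prodMk (hF'.mono Set.inter_subset_right),
    fun y hy => Prod.ext (hFf y hy.1) (hFf' y hy.2)⟩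

theorem SimplexSmooth.of_contMDiffOn {g : (Fin k → ℝ) → M} {O : Set (Fin k → ℝ)} (hO : IsOpen O)
    (hg : ContMDiffOn 𝓘(ℝ, Fin k → ℝ) I ∞ g O) (h : simplexSet k ⊆ O) :
    SimplexSmooth I (fun x : Simplex k => g x.1) :=
  fun x => ⟨O, g, hO, h x.2, hg, fun _ _ => rfl⟩

theorem SimplexSmooth.const (c : M) : SimplexSmooth I (fun _ : Simplex k => c) :=
  fun _ => ⟨Set.univ, fun _ => c, isOpen_univ, trivial, contMDiffOn_const, fun _ _ => rfl⟩

end SimplexSmooth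

/-! ### Bundles over cylinders -/

section Cylinder

variable (d : ℕ) (Y : Type y) [TopologicalSpace Y] [ChartedSpace (EuclideanSpace ℝ (Fin d)) Y]

/-- The smooth simplicial set of the smooth simplices of the cylinder `Y × ℝ`. -/
noncomputable abbrev cylinder : SmoothSSet.{y} :=
  (SmoothSSet.sing (𝓡 d) Y).prod (SmoothSSet.sing 𝓘(ℝ, ℝ) ℝ)

variable {d Y}

/-- The simplex of the cylinder with the given components. -/
noncomputable def cylinderSimplex {n : ℕ} {f : Simplex n → Y} (hf : SimplexSmooth (𝓡 d) f)
    {τ : Simplex n → ℝ} (hτ : SimplexSmooth 𝓘(ℝ, ℝ) τ) : (cylinder d Y).obj n := (⟨f, hf⟩, ⟨τ, hτ⟩)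

theorem cylinderSimplex_congr {n : ℕ} {f f' : Simplex n → Y} (hf : SimplexSmooth (𝓡 d) f)
    (hf' : SimplexSmooth (𝓡 d) f') {τ τ' : Simplex n → ℝ}
    (hτ : SimplexSmooth 𝓘(ℝ, ℝ) τ) (hτ' : SimplexSmooth 𝓘(ℝ, ℝ) τ') (h : ∀ x, f x = f' x)
    (h' : ∀ x, τ x = τ' x) : cylinderSimplex hf hτ = cylinderSimplex hf' hτ' := by
  obtain rfl : f = f' := funext h
  obtain rfl : τ = τ' := funext h'
  rfl

variable {E : Type v} [AddCommGroup E] [Module ℝ E] [TopologicalSpace E]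
  {G : Type u} [TopologicalSpace G] [ChartedSpace E G] [Group G]

/-- The function `γ` describes, with respect to the chosen frames, a section of the bundle `P` over
the set `O` that is smooth along all simplices. -/
def SmoothFrameOn (P : SimplicialGBundle E G (cylinder d Y)) (γ : Y × ℝ → G) (O : Set (Y × ℝ)) :
    Prop :=
  ∀ {n : ℕ} {f : Simplex n → Y} (hf : SimplexSmooth (𝓡 d) f) {τ : Simplex n → ℝ}
    (hτ : SimplexSmooth 𝓘(ℝ, ℝ) τ) (x : Simplex n), (f x, τ x) ∈ O →
    P.SmoothFrameAt (cylinderSimplex hf hτ) (fun z => γ (f z, τ z)) x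

theorem SmoothFrameOn.mono {P : SimplicialGBundle E G (cylinder d Y)} {γ : Y × ℝ → G}
    {O O' : Set (Y × ℝ)} (h : SmoothFrameOn P γ O) (hO : O' ⊆ O) : SmoothFrameOn P γ O' :=
  fun hf _ hτ x hx => h hf hτ x (hO hx)

variable [IsTopologicalAddGroup E] [ContinuousSMul ℝ E] [LocallyConvexSpace ℝ E]
  [T2Space E] [IsFrechetLieGroup E G] {P : SimplicialGBundle E G (cylinder d Y)}

/-- Smoothness of a section at `x` depends only on the germ of the simplex at `x`. -/
theorem SimplicialGBundle.SmoothFrameAt.of_eventuallyEq {n : ℕ} {f : Simplex n → Y}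
    (hf : SimplexSmooth (𝓡 d) f) {τ τ' : Simplex n → ℝ}
    (hτ : SimplexSmooth 𝓘(ℝ, ℝ) τ) (hτ' : SimplexSmooth 𝓘(ℝ, ℝ) τ') {x : Simplex n}
    {c : Simplex n → G} (h : P.SmoothFrameAt (cylinderSimplex hf hτ) c x)
    (hx : ∀ᶠ z in 𝓝 x, τ z = τ' z) :
    P.SmoothFrameAt (cylinderSimplex hf hτ') c x := by
  -- After composition with `ρ` the two simplices coincide, while nothing changes near `x`;
  -- smoothness passes down to the common restriction and back up.
  obtain ⟨ρ, hρx, hρ⟩ := exists_smoothMap_localizing hx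
  have h1 : (cylinder d Y).map ρ (cylinderSimplex hf hτ) =
      (cylinder d Y).map ρ (cylinderSimplex hf hτ') :=
    cylinderSimplex_congr (hf.comp ρ) (hf.comp ρ) (hτ.comp ρ) (hτ'.comp ρ) (fun _ => rfl) hρ
  have h2 : P.SmoothFrameAt (cylinderSimplex hf hτ) c (ρ.toFun x) := by
    rwa [hρx.self_of_nhds]
  exact (h2.comp h1).of_comp rfl hρx

/-- Two smooth sections over products of a set with overlapping intervals can be glued. -/
theorem SmoothFrameOn.glue {V : Set Y} {a b a' b' : ℝ} {γ γ' : Y × ℝ → G}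
    (h : SmoothFrameOn P γ (V ×ˢ Set.Ioo a b)) (h' : SmoothFrameOn P γ' (V ×ˢ Set.Ioo a' b'))
    (hab : max a a' < min b b') : ∃ γ'' : Y × ℝ → G, SmoothFrameOn P γ'' (V ×ˢ Set.Ioo a b') := by
  classical
  obtain ⟨m, hm1, hm2⟩ := exists_between hab
  obtain ⟨δ, hδ, hδm⟩ := Metric.isOpen_iff.1 (isOpen_Ioo (a := max a a') (b := min b b')) m
    ⟨hm1, hm2⟩
  obtain ⟨r, hr, hrm, hrδ, -⟩ := exists_contDiff_localizing m hδ
  rw [max_lt_iff] at hm1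
  rw [lt_min_iff] at hm2
  -- Above `m` the section `γ'` is corrected by `γ'⁻¹ γ` evaluated at height `r t`, which always
  -- lies in the overlap. Near `m` one has `r t = t`, so there the corrected section is `γ` itself.
  refine ⟨fun p => if p.2 ≤ m then γ p else
    γ' p * ((γ' (p.1, r p.2))⁻¹ * γ (p.1, r p.2)), ?_⟩
  intro n f hf τ hτ x hx
  have hτc : Continuous τ := hτ.continuous
  obtain ⟨hxV, hxa, hxb⟩ := hx
  simp only at hxV hxa hxb
  rcases lt_trichotomy (τ x) m with hlt | heq | hgt
  · refine (h hf hτ x ⟨hxV, hxa, hlt.trans hm2.1⟩).congr ?_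
    filter_upwards [hτc.continuousAt.eventually (gt_mem_nhds hlt)] with z hz
    rw [if_pos hz.le]
  · refine (h hf hτ x ⟨hxV, hxa, heq ▸ hm2.1⟩).congr ?_
    have h1 : ∀ᶠ z in 𝓝 x, r (τ z) = τ z :=
      hτc.continuousAt.eventually (heq ▸ hrm)
    filter_upwards [h1] with z hz
    split_ifs with hz'
    · rfl
    · rw [hz, mul_inv_cancel_left]
  · have hr' : SimplexSmooth 𝓘(ℝ, ℝ) (fun z => r (τ z)) := hτ.contMDiff_comp hr.contMDiff
    have h0 := hδm (hrδ (τ x))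
    rw [Set.mem_Ioo, max_lt_iff, lt_min_iff] at h0
    have h1 := h hf hr' x ⟨hxV, h0.1.1, h0.2.1⟩
    have h2 := h' hf hr' x ⟨hxV, h0.1.2, h0.2.2⟩
    refine ((h' hf hτ x ⟨hxV, hm1.2.trans hgt, hxb⟩).mul (h2.div h1)).congr ?_
    filter_upwards [hτc.continuousAt.eventually (lt_mem_nhds hgt)] with z hz
    rw [if_neg (not_le.2 hz)]

end Cylinder

/-! ### Local smooth sections over the cylinder -/

section LocalSections

variable {d : ℕ} {Y : Type y} [TopologicalSpace Y] [ChartedSpace (EuclideanSpace ℝ (Fin d)) Y]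

/-- Every point of `Y × ℝ` has a neighbourhood that is parametrized by a simplex. -/
theorem exists_cylinderSimplex_parametrization [IsManifold (𝓡 d) ∞ Y] (y₀ : Y) (t₀ : ℝ) :
    ∃ (f : Simplex (d + 1) → Y) (_ : SimplexSmooth (𝓡 d) f) (τ : Simplex (d + 1) → ℝ)
      (_ : SimplexSmooth 𝓘(ℝ, ℝ) τ) (O : Set (Y × ℝ)) (κ : Y × ℝ → (Fin (d + 1) → ℝ)),
      IsOpen O ∧ (y₀, t₀) ∈ O ∧
      ContMDiffOn ((𝓡 d).prod 𝓘(ℝ, ℝ)) 𝓘(ℝ, Fin (d + 1) → ℝ) ∞ κ O ∧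
      ∀ p ∈ O, ∃ h : κ p ∈ simplexSet (d + 1), (f ⟨κ p, h⟩, τ ⟨κ p, h⟩) = p := by
  set φ := chartAt (EuclideanSpace ℝ (Fin d)) y₀ with hφ
  let L : (Fin (d + 1) → ℝ) →L[ℝ] EuclideanSpace ℝ (Fin d) :=
    ((EuclideanSpace.equiv (Fin d) ℝ).symm : (Fin d → ℝ) →L[ℝ] EuclideanSpace ℝ (Fin d)).comp
      (ContinuousLinearMap.pi fun i => ContinuousLinearMap.proj i.succ)
  have hL : ∀ v i, L v i = v (Fin.succ i) := fun v i => rfl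
  -- Coordinate 0 of the simplex is the height; the other `d` coordinates belong to the chart of
  -- `Y`.
  let K : EuclideanSpace ℝ (Fin d) × ℝ → (Fin (d + 1) → ℝ) := fun p => Fin.cons p.2 fun i => p.1 i
  have hK : ContDiff ℝ ∞ K := by
    rw [contDiff_pi]
    intro i
    refine Fin.cases ?_ (fun i => ?_) i
    · exact contDiff_snd
    · simp only [K, Fin.cons_succ]
      fun_prop
  have hLK : ∀ p, L (K p) = p.1 := fun p => by
    ext i
    rw [hL]
    rfl
  -- All coordinates of the barycentre of `Δ^(d+1)`: they are positive with sum `(d+1)/(d+2) < 1`,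
  -- so the base point is interior.
  set c : ℝ := 1 / (d + 2) with hc
  have hd : (0 : ℝ) < d + 2 := by positivity
  have hc0 : 0 < c := by positivity
  have hc1 : c ≤ 1 := by
    rw [hc, div_le_one hd]
    linarith [Nat.cast_nonneg (α := ℝ) d]
  let b : Fin (d + 1) → ℝ := fun _ => c
  obtain ⟨r, hr, hrφ⟩ := Metric.isOpen_iff.1 φ.open_target _
    (φ.map_source (mem_chart_source _ y₀))
  -- The scale keeps the image of the whole simplex inside the chart target; the summand 1 covers
  -- `‖L‖ = 0`.
  set ε : ℝ := r / (‖L‖ + 1) with hε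
  have hLpos : 0 < ‖L‖ + 1 := by positivity
  have hε0 : 0 < ε := div_pos hr hLpos
  have hmem : ∀ u ∈ simplexSet (d + 1), φ y₀ + ε • L (u - b) ∈ φ.target := by
    intro u hu
    apply hrφ
    rw [mem_ball_iff_norm, add_sub_cancel_left, norm_smul, Real.norm_of_nonneg hε0.le]
    have h1 : ‖u - b‖ ≤ 1 := by
      rw [pi_norm_le_iff_of_nonneg zero_le_one]
      intro i
      have h2 : u i ≤ 1 := (Finset.single_le_sum (f := u) (fun j _ => hu.1 j)
        (Finset.mem_univ i)).trans hu.2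
      rw [Pi.sub_apply, Real.norm_eq_abs, abs_le]
      constructor <;> linarith [hu.1 i]
    have h2 : ‖L (u - b)‖ ≤ ‖L‖ := (L.le_opNorm _).trans (mul_le_of_le_one_right (norm_nonneg _) h1)
    calc ε * ‖L (u - b)‖ ≤ ε * ‖L‖ := by gcongr
      _ < ε * (‖L‖ + 1) := by gcongr; linarith
      _ = r := div_mul_cancel₀ _ hLpos.ne'
  have haff : ContDiff ℝ ∞ fun u : Fin (d + 1) → ℝ => φ y₀ + ε • L (u - b) := by fun_prop
  have hf : SimplexSmooth (𝓡 d) fun u : Simplex (d + 1) => φ.symm (φ y₀ + ε • L (u.1 - b)) :=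
    SimplexSmooth.of_contMDiffOn (k := d + 1) (g := fun u => φ.symm (φ y₀ + ε • L (u - b)))
      (O := (fun u : Fin (d + 1) → ℝ => φ y₀ + ε • L (u - b)) ⁻¹' φ.target)
      (φ.open_target.preimage haff.continuous)
      ((contMDiffOn_chart_symm (I := 𝓡 d) (x := y₀)).comp haff.contMDiff.contMDiffOn subset_rfl) hmem
  have hτ : SimplexSmooth 𝓘(ℝ, ℝ) fun u : Simplex (d + 1) => t₀ + ε * (u.1 0 - c) :=
    SimplexSmooth.of_contMDiffOn (k := d + 1) (g := fun u => t₀ + ε * (u 0 - c)) isOpen_univ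
      (ContDiff.contMDiff (by fun_prop)).contMDiffOn (Set.subset_univ _)
  let κ : Y × ℝ → (Fin (d + 1) → ℝ) := fun p => b + ε⁻¹ • K (φ p.1 - φ y₀, p.2 - t₀)
  have hκ : ContMDiffOn ((𝓡 d).prod 𝓘(ℝ, ℝ)) 𝓘(ℝ, Fin (d + 1) → ℝ) ∞ κ
      (φ.source ×ˢ Set.univ) := by
    have h1 : ContDiff ℝ ∞ fun p : EuclideanSpace ℝ (Fin d) × ℝ =>
        b + ε⁻¹ • K (p.1 - φ y₀, p.2 - t₀) := by
      have : ContDiff ℝ ∞ fun p : EuclideanSpace ℝ (Fin d) × ℝ => K (p.1 - φ y₀, p.2 - t₀) :=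
        hK.comp (by fun_prop)
      fun_prop
    have h2 : ContMDiffOn ((𝓡 d).prod 𝓘(ℝ, ℝ)) 𝓘(ℝ, EuclideanSpace ℝ (Fin d) × ℝ) ∞
        (fun p : Y × ℝ => (φ p.1, p.2)) (φ.source ×ˢ Set.univ) :=
      ((contMDiffOn_chart (I := 𝓡 d) (x := y₀)).comp contMDiffOn_fst fun p hp => hp.1).prodMk_space
        contMDiffOn_snd
    exact h1.contMDiff.comp_contMDiffOn h2
  -- On this open part of the simplex `κ` inverts the affine parametrization.
  let W : Set (Fin (d + 1) → ℝ) := {v | (∀ i, 0 < v i) ∧ ∑ i, v i < 1}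
  have hW : IsOpen W := by
    refine IsOpen.and ?_ (isOpen_lt (by fun_prop) continuous_const)
    rw [Set.ofPred_forall]
    exact isOpen_iInter_of_finite fun i => isOpen_lt continuous_const (continuous_apply i)
  have hWs : W ⊆ simplexSet (d + 1) := fun v hv => ⟨fun i => (hv.1 i).le, hv.2.le⟩
  refine ⟨_, hf, _, hτ, (φ.source ×ˢ Set.univ) ∩ κ ⁻¹' W, κ,
    hκ.continuousOn.isOpen_inter_preimage (φ.open_source.prod isOpen_univ) hW,
    ⟨⟨mem_chart_source _ y₀, trivial⟩, ?_⟩, hκ.mono Set.inter_subset_left, ?_⟩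
  · have h0 : κ (y₀, t₀) = b := by
      have : K (0, 0) = 0 := by
        funext i
        refine Fin.cases rfl (fun i => rfl) i
      simp only [κ, sub_self]
      rw [this, smul_zero, add_zero]
    rw [Set.mem_preimage, h0]
    refine ⟨fun _ => hc0, ?_⟩
    simp only [b, Finset.sum_const, Finset.card_univ, Fintype.card_fin, nsmul_eq_mul]
    rw [hc, mul_one_div, div_lt_one hd]
    push_cast
    linarith
  · rintro ⟨y, t⟩ ⟨⟨hy, -⟩, hp⟩
    refine ⟨hWs hp, Prod.ext ?_ ?_⟩
    · simp only [κ, add_sub_cancel_left, map_smul, hLK, smul_smul, mul_inv_cancel₀ hε0.ne',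
        one_smul, add_sub_cancel]
      exact φ.left_inv hy
    · have h1 : κ (y, t) 0 = c + ε⁻¹ * (t - t₀) := rfl
      simp only [h1]
      field_simp
      ring

variable {E : Type v} [AddCommGroup E] [Module ℝ E] [TopologicalSpace E]
  {G : Type u} [TopologicalSpace G] [ChartedSpace E G] [Group G]
  [IsTopologicalAddGroup E] [ContinuousSMul ℝ E] [LocallyConvexSpace ℝ E]
  [T2Space E] [IsFrechetLieGroup E G]

/-- A section over one parametrizing simplex suffices: near each of its points in `O`, any simplex
of the cylinder factors smoothly through the parametrizing one by `κ`. -/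
theorem exists_smoothFrameOn_nhds [IsManifold (𝓡 d) ∞ Y]
    (P : SimplicialGBundle E G (cylinder d Y)) (y₀ : Y) (t₀ : ℝ) :
    ∃ O ∈ 𝓝 (y₀, t₀), ∃ γ, SmoothFrameOn P γ O := by
  classical
  obtain ⟨f₀, hf₀, τ₀, hτ₀, O, κ, hO, hyO, hκ, hinv⟩ :=
    exists_cylinderSimplex_parametrization (d := d) y₀ t₀
  obtain ⟨hκ₀, -⟩ := hinv _ hyO
  obtain ⟨c, hc⟩ := P.exists_smoothFrameAt (cylinderSimplex hf₀ hτ₀) ⟨κ (y₀, t₀), hκ₀⟩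
  obtain ⟨W, hW, hyW, hWc⟩ := exists_open_of_mem_nhds_simplex hc.eventually
  have hOW : IsOpen (O ∩ κ ⁻¹' W) := hκ.continuousOn.isOpen_inter_preimage hO hW
  refine ⟨O ∩ κ ⁻¹' W, hOW.mem_nhds ⟨hyO, hyW⟩,
    -- The default value 1 is irrelevant, since `κ` maps `O` into the simplex.
    fun p => if h : κ p ∈ simplexSet (d + 1) then c ⟨κ p, h⟩ else 1, ?_⟩
  intro n f hf τ hτ x hx
  have hcont : Continuous fun z => (f z, τ z) := hf.continuous.prodMk hτ.continuous
  obtain ⟨ρ, hρx, hρ⟩ := exists_smoothMap_localizing (x := x)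
    ((hOW.preimage hcont).mem_nhds hx)
  choose hmem heq using hinv
  -- Localizing by `ρ` first keeps the whole simplex inside `O`, so this factorization is defined on
  -- all of `Δ^n`.
  let σ : SmoothMap n (d + 1) :=
    { toFun := fun z => ⟨κ (f (ρ.toFun z), τ (ρ.toFun z)), hmem _ (hρ z).1⟩
      smooth := ((hf.comp ρ).prodMk (hτ.comp ρ)).contMDiffOn_comp hO hκ fun z => (hρ z).1 }
  have hσ : (cylinder d Y).map σ (cylinderSimplex hf₀ hτ₀) =
      (cylinder d Y).map ρ (cylinderSimplex hf hτ) :=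
    cylinderSimplex_congr (hf₀.comp σ) (hf.comp ρ) (hτ₀.comp σ) (hτ.comp ρ)
      (fun z => congrArg Prod.fst (heq _ (hρ z).1)) (fun z => congrArg Prod.snd (heq _ (hρ z).1))
  have h1 : P.SmoothFrameAt (cylinderSimplex hf₀ hτ₀) c (σ.toFun x) :=
    hWc _ (hρ x).2
  refine SimplicialGBundle.SmoothFrameAt.of_comp rfl hρx ?_
  refine (h1.comp hσ).congr (Filter.Eventually.of_forall fun z => ?_)
  have hz : κ (f (ρ.toFun z), τ (ρ.toFun z)) ∈ simplexSet (d + 1) := hmem _ (hρ z).1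
  simp only [dif_pos hz]
  rfl

/-- The bundle has a smooth section over the product of a neighbourhood of any point of `Y` and
the unit interval. -/
theorem exists_smoothFrameOn_prod [IsManifold (𝓡 d) ∞ Y]
    (P : SimplicialGBundle E G (cylinder d Y)) (y₀ : Y) :
    ∃ V ∈ 𝓝 y₀, ∃ γ, SmoothFrameOn P γ (V ×ˢ Set.Icc 0 1) := by
  -- Sections over open intervals from below 0 to beyond `t`; a supremum argument brings `t` up to
  -- 1, with `V` shrinking at each gluing.
  let p : ℝ → Prop := fun t => ∃ V ∈ 𝓝 y₀, ∃ a < 0, ∃ b > max t 0, ∃ γ,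
    SmoothFrameOn P γ (V ×ˢ Set.Ioo a b)
  have hloc : ∀ t : ℝ, ∃ V ∈ 𝓝 y₀, ∃ ε > 0, ∃ γ,
      SmoothFrameOn P γ (V ×ˢ Set.Ioo (t - ε) (t + ε)) := by
    intro t
    obtain ⟨O, hO, γ, hγ⟩ := exists_smoothFrameOn_nhds P y₀ t
    rw [nhds_prod_eq, Filter.mem_prod_iff] at hO
    obtain ⟨V, hV, J, hJ, hVJ⟩ := hO
    obtain ⟨ε, hε, hεJ⟩ := Metric.mem_nhds_iff.1 hJ
    rw [Real.ball_eq_Ioo] at hεJ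
    exact ⟨V, hV, ε, hε, γ, hγ.mono ((Set.prod_mono_right hεJ).trans hVJ)⟩
  -- The same `ε` serves on both sides of `t`, so the supremum need not be attained to be exceeded.
  have hstep : ∀ t ≥ 0, ∃ ε > 0, ∀ s > t - ε, p s → ∀ s' < t + ε, p s' := by
    intro t ht
    obtain ⟨V, hV, ε, hε, γ, hγ⟩ := hloc t
    refine ⟨ε, hε, fun s hs hps s' hs' => ?_⟩
    obtain ⟨V', hV', a, ha, b, hb, γ', hγ'⟩ := hps
    rw [gt_iff_lt, max_lt_iff] at hb
    rcases lt_or_ge s' b with h | h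
    · exact ⟨V', hV', a, ha, b, max_lt h hb.2, γ', hγ'⟩
    · obtain ⟨γ'', h''⟩ := SmoothFrameOn.glue
        (hγ'.mono (Set.prod_mono_left (Set.inter_subset_left (t := V))))
        (hγ.mono (Set.prod_mono_left Set.inter_subset_right))
        (max_lt (lt_min (by linarith) (by linarith)) (lt_min (by linarith) (by linarith)))
      exact ⟨_, Filter.inter_mem hV' hV, a, ha, _, max_lt hs' (by linarith), γ'', h''⟩
  have h0 : p 0 := by
    obtain ⟨V, hV, ε, hε, γ, hγ⟩ := hloc 0
    exact ⟨V, hV, 0 - ε, by linarith, 0 + ε, by simpa using hε, γ, hγ⟩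
  have h1 : p 1 := by
    by_contra hp1
    have hmono : ∀ s, p s → s < 1 := by
      intro s hs
      by_contra hs1
      obtain ⟨V, hV, a, ha, b, hb, γ, hγ⟩ := hs
      rw [gt_iff_lt, max_lt_iff] at hb
      exact hp1 ⟨V, hV, a, ha, b, max_lt (by linarith) hb.2, γ, hγ⟩
    have hbdd : BddAbove {t | p t} := ⟨1, fun s hs => (hmono s hs).le⟩
    have ht0 : 0 ≤ sSup {t | p t} := le_csSup hbdd h0
    obtain ⟨ε, hε, h⟩ := hstep _ ht0
    obtain ⟨s, hs, hsε⟩ := exists_lt_of_lt_csSup (s := {t | p t}) ⟨0, h0⟩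
      (show sSup {t | p t} - ε < sSup {t | p t} by linarith)
    have h2 := le_csSup hbdd (h s hsε hs (sSup {t | p t} + ε / 2) (by linarith))
    linarith
  obtain ⟨V, hV, a, ha, b, hb, γ, hγ⟩ := h1
  rw [gt_iff_lt, max_lt_iff] at hb
  exact ⟨V, hV, γ, hγ.mono (Set.prod_mono_right fun t ht => ⟨ha.trans_le ht.1, ht.2.trans_lt hb.1⟩)⟩

end LocalSections

/-! ### Transport through a partition of unity and homotopy invariance -/

section Homotopy

variable {d : ℕ} {Y : Type y} [TopologicalSpace Y] [ChartedSpace (EuclideanSpace ℝ (Fin d)) Y]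

/-- The partial sums of a sequence of functions. -/
def partialSum (l : ℕ → Y → ℝ) (k : ℕ) (x : Y) : ℝ := ∑ i ∈ Finset.range k, l i x

theorem partialSum_succ (l : ℕ → Y → ℝ) (k : ℕ) (x : Y) :
    partialSum l (k + 1) x = partialSum l k x + l k x := Finset.sum_range_succ _ _

theorem contMDiff_partialSum {l : ℕ → Y → ℝ} (hl : ∀ i, ContMDiff (𝓡 d) 𝓘(ℝ, ℝ) ∞ (l i)) (k : ℕ) :
    ContMDiff (𝓡 d) 𝓘(ℝ, ℝ) ∞ (partialSum l k) :=
  contMDiff_finsetSum fun i _ => hl i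

variable {G : Type u} [Group G]

/-- The product of the transports from height `s_i` to height `s_(i+1)`, for `i < k`, where the `i`-th
transport is constant with respect to the frames `γ i`, and `s_i` is the sum of the functions `l j`,
`j < i`. -/
def transport (γ : ℕ → Y × ℝ → G) (l : ℕ → Y → ℝ) : ℕ → Y → G
  | 0, _ => 1
  | k + 1, x => γ k (x, partialSum l (k + 1) x) * (γ k (x, partialSum l k x))⁻¹ *
      transport γ l k x

theorem transport_succ_of_eq_zero (γ : ℕ → Y × ℝ → G) {l : ℕ → Y → ℝ} {k : ℕ} {x : Y}
    (h : l k x = 0) : transport γ l (k + 1) x = transport γ l k x := by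
  rw [transport, partialSum_succ, h, add_zero, mul_inv_cancel, one_mul]

theorem transport_eq_of_le (γ : ℕ → Y × ℝ → G) {l : ℕ → Y → ℝ} {N : ℕ} {x : Y}
    (h : ∀ k ≥ N, l k x = 0) {k : ℕ} (hk : N ≤ k) : transport γ l k x = transport γ l N x := by
  induction k, hk using Nat.le_induction with
  | base => rfl
  | succ k hk ih => rw [transport_succ_of_eq_zero γ (h k hk), ih]

variable {E : Type v} [AddCommGroup E] [Module ℝ E] [TopologicalSpace E]
  [TopologicalSpace G] [ChartedSpace E G]
  [IsTopologicalAddGroup E] [ContinuousSMul ℝ E] [LocallyConvexSpace ℝ E]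
  [T2Space E] [IsFrechetLieGroup E G]
  {P : SimplicialGBundle E G (cylinder d Y)}

/-- Over `V k` the quotient of the current section by `γ k` at the old height is a smooth germ, and
multiplying it onto `γ k` at the new height performs the next step. Outside `V k` neither height nor
product changes. -/
theorem smoothFrameAt_transport {γ : ℕ → Y × ℝ → G} {l : ℕ → Y → ℝ} {V : ℕ → Set Y}
    (hγ : ∀ k, SmoothFrameOn P (γ k) (V k ×ˢ Set.Icc 0 1))
    (hl : ∀ i, ContMDiff (𝓡 d) 𝓘(ℝ, ℝ) ∞ (l i)) (hl0 : ∀ i x, 0 ≤ l i x)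
    (hl1 : ∀ k x, partialSum l k x ≤ 1) (hlV : ∀ k, tsupport (l k) ⊆ V k)
    {n : ℕ} {f : Simplex n → Y} (hf : SimplexSmooth (𝓡 d) f) {c : Simplex n → G} {x : Simplex n}
    (hc : P.SmoothFrameAt (cylinderSimplex hf (SimplexSmooth.const 0)) c x) (k : ℕ) :
    P.SmoothFrameAt (cylinderSimplex hf (hf.contMDiff_comp (contMDiff_partialSum hl k)))
      (fun z => transport γ l k (f z) * c z) x := by
  have hmem : ∀ k z, partialSum l k z ∈ Set.Icc (0 : ℝ) 1 := fun k z =>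
    ⟨Finset.sum_nonneg fun i _ => hl0 i z, hl1 k z⟩
  induction k with
  | zero =>
    refine (SimplicialGBundle.SmoothFrameAt.of_eventuallyEq hf _ _ hc
      (Filter.Eventually.of_forall fun z => ?_)).congr (Filter.Eventually.of_forall fun z => ?_)
    · simp [partialSum]
    · simp [transport]
  | succ k ih =>
    by_cases hx : f x ∈ V k
    · have h1 := hγ k hf (hf.contMDiff_comp (contMDiff_partialSum hl k)) x ⟨hx, hmem _ _⟩
      have h2 := hγ k hf (hf.contMDiff_comp (contMDiff_partialSum hl (k + 1))) x ⟨hx, hmem _ _⟩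
      refine (h2.mul (h1.div ih)).congr (Filter.Eventually.of_forall fun z => ?_)
      simp only [transport, mul_assoc]
    -- The closed support is needed here: `l k` must vanish on a neighbourhood, not just at `f x`.
    · have h0 : ∀ᶠ z in 𝓝 x, l k (f z) = 0 := by
        have hop : IsOpen (f ⁻¹' (tsupport (l k))ᶜ) :=
          (isClosed_tsupport _).isOpen_compl.preimage hf.continuous
        filter_upwards [hop.mem_nhds fun h => hx (hlV k h)] with z hz
        exact image_eq_zero_of_notMem_tsupport hz
      refine (SimplicialGBundle.SmoothFrameAt.of_eventuallyEq hf _ _ ih ?_).congr ?_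
      · filter_upwards [h0] with z hz
        rw [partialSum_succ, hz, add_zero]
      · filter_upwards [h0] with z hz
        rw [transport_succ_of_eq_zero γ hz]

variable (d Y) in
/-- The inclusion of `Y` in the cylinder at the height `t`. -/
noncomputable def cylinderInclusion (t : ℝ) :
    Hom (SmoothSSet.sing (𝓡 d) Y) (cylinder d Y) where
  app f := cylinderSimplex f.2 (SimplexSmooth.const t)
  naturality _ _ := rfl

theorem exists_countable_smoothFrameOn [SecondCountableTopology Y] [IsManifold (𝓡 d) ∞ Y]
    (P : SimplicialGBundle E G (cylinder d Y)) :
    ∃ (V : ℕ → Set Y) (γ : ℕ → Y × ℝ → G), (∀ k, IsOpen (V k)) ∧ (⋃ k, V k) = Set.univ ∧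
      ∀ k, SmoothFrameOn P (γ k) (V k ×ˢ Set.Icc 0 1) := by
  -- Enumerating the countable cover by `ℕ` requires it to be nonempty.
  rcases isEmpty_or_nonempty Y with hY | hY
  · refine ⟨fun _ => ∅, fun _ _ => 1, fun _ => isOpen_empty, Set.eq_univ_of_forall fun x =>
      hY.elim x, fun k => ?_⟩
    intro n f hf τ hτ x hx
    exact hx.1.elim
  · choose V hV γ hγ using exists_smoothFrameOn_prod P
    obtain ⟨s, hs, hsV⟩ := TopologicalSpace.countable_cover_nhds
      (f := fun x => interior (V x)) fun x => interior_mem_nhds.2 (hV x)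
    have hne : s.Nonempty := by
      by_contra h
      rw [Set.not_nonempty_iff_eq_empty] at h
      subst h
      obtain ⟨x⟩ := hY
      have := hsV.symm.subset (Set.mem_univ x)
      simp at this
    obtain ⟨g, rfl⟩ := hs.exists_eq_range hne
    refine ⟨fun k => interior (V (g k)), fun k => γ (g k), fun k => isOpen_interior, ?_,
      fun k => SmoothFrameOn.mono (hγ (g k)) (Set.prod_mono_left interior_subset)⟩
    rwa [Set.biUnion_range] at hsV

/-- The restrictions of a bundle over the cylinder to the heights `0` and `1` are isomorphic. -/
theorem cylinder_isomorphic [T2Space Y] [SecondCountableTopology Y] [IsManifold (𝓡 d) ∞ Y]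
    (P : SimplicialGBundle E G (cylinder d Y)) :
    (P.pullback (cylinderInclusion d Y 0)).Isomorphic (P.pullback (cylinderInclusion d Y 1)) := by
  obtain ⟨V, γ, hV, hVu, hγ⟩ := exists_countable_smoothFrameOn P
  have hlc : LocallyCompactSpace Y := ChartedSpace.locallyCompactSpace (EuclideanSpace ℝ (Fin d)) Y
  obtain ⟨p, hp⟩ := SmoothPartitionOfUnity.exists_isSubordinate (𝓡 d) isClosed_univ V hV
    hVu.symm.subset
  let l : ℕ → Y → ℝ := fun k => p k
  have hl : ∀ i, ContMDiff (𝓡 d) 𝓘(ℝ, ℝ) ∞ (l i) := fun i => (p i).contMDiff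
  have hl0 : ∀ i x, 0 ≤ l i x := p.nonneg
  have hsum : ∀ x, ∑ᶠ i, l i x = 1 := fun x => p.sum_eq_one (Set.mem_univ x)
  have hfin : ∀ x, (Function.support fun i => l i x).Finite := fun x =>
    p.locallyFinite.point_finite x
  have hl1 : ∀ k x, partialSum l k x ≤ 1 := by
    intro k x
    rw [← hsum x, partialSum,
      finsum_eq_sum_of_support_subset (s := Finset.range k ∪ (hfin x).toFinset)]
    · exact Finset.sum_le_sum_of_subset_of_nonneg Finset.subset_union_left fun i _ _ => hl0 i x
    · simp
  -- Local finiteness makes the infinite product of transports stop at an index that is uniform near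
  -- each point.
  have hloc : ∀ x, ∃ N, ∀ᶠ z in 𝓝 x, ∀ k ≥ N, l k z = 0 := by
    intro x
    obtain ⟨U, hU, hfU⟩ := p.locallyFinite x
    obtain ⟨N, hN⟩ := hfU.bddAbove
    refine ⟨N + 1, ?_⟩
    filter_upwards [hU] with z hz k hk
    by_contra h
    have := hN (a := k) ⟨z, h, hz⟩
    omega
  have hone : ∀ x N, (∀ k ≥ N, l k x = 0) → partialSum l N x = 1 := by
    intro x N h
    rw [← hsum x, partialSum]
    refine (finsum_eq_sum_of_support_subset _ fun i hi => ?_).symm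
    by_contra hi'
    exact hi (h i (by simpa using hi'))
  choose N hN using hloc
  -- The function of the points is the stable value of the transport, read off at the only point of
  -- `Δ^0`.
  refine SimplicialGBundle.pullback_isomorphic _ _
    (fun z => transport γ l (N (z.1 ⟨fun _ => 0, by simp [simplexSet]⟩))
      (z.1 ⟨fun _ => 0, by simp [simplexSet]⟩)) ?_
  rintro n ⟨f, hf⟩ c x hc
  -- Near `x` the fixed index `N (f x)` replaces the possibly discontinuous `N (f z)`: both lie in
  -- the stable range, and the height reached is 1.
  have h1 := smoothFrameAt_transport hγ hl hl0 hl1 hp hf hc (N (f x))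
  have hx : ∀ᶠ z in 𝓝 x, ∀ k ≥ N (f x), l k (f z) = 0 :=
    hf.continuous.continuousAt.eventually (hN (f x))
  refine (SimplicialGBundle.SmoothFrameAt.of_eventuallyEq hf _ (SimplexSmooth.const 1) h1
    ?_).congr ?_
  · filter_upwards [hx] with z hz
    exact hone _ _ hz
  · filter_upwards [hx] with z hz
    have h2 : transport γ l (N (f x)) (f z) = transport γ l (N (f z)) (f z) := by
      rcases le_total (N (f x)) (N (f z)) with h | h
      · exact (transport_eq_of_le γ hz h).symm
      · exact transport_eq_of_le γ (hN (f z)).self_of_nhds h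
    rw [h2]
    rfl

/-- The map from the cylinder to `Y × Δ^1` given by a smooth step function. -/
noncomputable def cylinderToProd :
    Hom (cylinder d Y) ((SmoothSSet.sing (𝓡 d) Y).prod (SmoothSSet.std 1)) where
  app S := (S.1,
    -- The step function has values in `[0,1]`, so arbitrary real heights are allowed, and it takes
    -- heights 0 and 1 to the vertices.
    { toFun := fun x => ⟨fun _ => Real.smoothTransition (S.2.1 x), by
        simp [simplexSet, Real.smoothTransition.nonneg, Real.smoothTransition.le_one]⟩
      smooth := S.2.2.contMDiff_comp (M' := Fin 1 → ℝ) (I' := 𝓘(ℝ, Fin 1 → ℝ))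
        (g := fun t _ => Real.smoothTransition t)
        (contDiff_pi.2 fun _ => Real.smoothTransition.contDiff).contMDiff })
  naturality _ _ := rfl

theorem cylinderToProd_comp_zero :
    (cylinderToProd (d := d) (Y := Y)).comp (cylinderInclusion d Y 0) =
      SmoothSSet.inclusion _ vertexZero := by
  ext n f
  refine Prod.ext rfl (SmoothMap.ext (funext fun x => Subtype.ext (funext fun i => ?_)))
  exact Real.smoothTransition.zero

theorem cylinderToProd_comp_one :
    (cylinderToProd (d := d) (Y := Y)).comp (cylinderInclusion d Y 1) =
      SmoothSSet.inclusion _ vertexOne := by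
  ext n f
  refine Prod.ext rfl (SmoothMap.ext (funext fun x => Subtype.ext (funext fun i => ?_)))
  exact Real.smoothTransition.one

theorem isomorphic_of_smoothlyHomotopic [T2Space Y] [SecondCountableTopology Y]
    [IsManifold (𝓡 d) ∞ Y] {f g : Hom (SmoothSSet.sing (𝓡 d) Y) (BG E G)}
    (h : SmoothlyHomotopic f g) : ((EG E G).pullback f).Isomorphic ((EG E G).pullback g) := by
  obtain ⟨H, hH⟩ := h
  have hf : (H.comp cylinderToProd).comp (cylinderInclusion d Y 0) = f := by
    change H.comp (cylinderToProd.comp (cylinderInclusion d Y 0)) = f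
    rw [cylinderToProd_comp_zero]
    ext n S
    exact (hH n S).1
  have hg : (H.comp cylinderToProd).comp (cylinderInclusion d Y 1) = g := by
    change H.comp (cylinderToProd.comp (cylinderInclusion d Y 1)) = g
    rw [cylinderToProd_comp_one]
    ext n S
    exact (hH n S).2
  rw [← hf, ← hg]
  exact cylinder_isomorphic ((EG E G).pullback (H.comp cylinderToProd))

end Homotopy

end SmoothSimplicial

theorem mainTheorem6
    (E : Type v) [AddCommGroup E] [Module ℝ E] [UniformSpace E] [IsUniformAddGroup E]
    [ContinuousSMul ℝ E] [LocallyConvexSpace ℝ E] [CompleteSpace E] [T2Space E]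
    (G : Type u) [TopologicalSpace G] [T2Space G] [ChartedSpace E G] [Group G]
    [SmoothSimplicial.IsFrechetLieGroup E G] :
    (∃ cl : ∀ X : SmoothSimplicial.SmoothSSet.{w}, SmoothSimplicial.SimplicialGBundle E G X →
        SmoothSimplicial.SmoothSSet.Hom X (SmoothSimplicial.BG E G),
      (∀ (X : SmoothSimplicial.SmoothSSet.{w}) (P : SmoothSimplicial.SimplicialGBundle E G X),
        (SmoothSimplicial.EG E G).pullback (cl X P) = P ∧
        SmoothSimplicial.Classifies (cl X P) P) ∧
      (∀ (X X' : SmoothSimplicial.SmoothSSet.{w}) (h : SmoothSimplicial.SmoothSSet.Hom X X')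
        (P : SmoothSimplicial.SimplicialGBundle E G X'),
        cl X (P.pullback h) = (cl X' P).comp h)) ∧
    (∀ (X : SmoothSimplicial.SmoothSSet.{w}) (P₁ P₂ : SmoothSimplicial.SimplicialGBundle E G X)
      (f₁ f₂ : SmoothSimplicial.SmoothSSet.Hom X (SmoothSimplicial.BG E G)),
      P₁.Isomorphic P₂ → SmoothSimplicial.Classifies f₁ P₁ → SmoothSimplicial.Classifies f₂ P₂ →
        SmoothSimplicial.SmoothlyHomotopic f₁ f₂) ∧
    (∀ (d : ℕ) (Y : Type y) [TopologicalSpace Y] [T2Space Y] [SecondCountableTopology Y]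
      [ChartedSpace (EuclideanSpace ℝ (Fin d)) Y] [IsManifold (𝓡 d) ∞ Y]
      (f g : SmoothSimplicial.SmoothSSet.Hom (SmoothSimplicial.SmoothSSet.sing (𝓡 d) Y)
        (SmoothSimplicial.BG E G)),
      SmoothSimplicial.SmoothlyHomotopic f g →
        ((SmoothSimplicial.EG E G).pullback f).Isomorphic
          ((SmoothSimplicial.EG E G).pullback g)) := by
  refine ⟨⟨fun X P => SmoothSimplicial.classifyingMap P, fun X P => ?_, fun X X' h P =>
    SmoothSimplicial.classifyingMap_pullback h P⟩, ?_, ?_⟩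
  · have h := SmoothSimplicial.EG_pullback_classifyingMap P
    refine ⟨h, ?_⟩
    rw [SmoothSimplicial.Classifies, h]
    exact SmoothSimplicial.SimplicialGBundle.isomorphic_refl P
  · rintro X P₁ P₂ f₁ f₂ ⟨i⟩ ⟨i₁⟩ ⟨i₂⟩
    -- The chain is `f₁^*EG ≅ P₁ ≅ P₂ ≅ f₂^*EG`.
    exact SmoothSimplicial.smoothlyHomotopic_of_isomorphic ⟨(i₁.trans i).trans i₂.symm⟩
  · intro d Y _ _ _ _ _ f g h
    exact SmoothSimplicial.isomorphic_of_smoothlyHomotopic h
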